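/- Let $q$ be an odd prime power and let $\alpha$ be a primitive element of $\mathbb{F}_q$. For $e\mid q-1$ put $D_0^e=\langle\alpha^e\rangle\subseteq\mathbb{F}_q^*$ and $D_i^e=\alpha^iD_0^e$ (so the index $i$ only matters modulo $e$). For $D\subseteq\mathbb{F}_q$ let $\mathrm{Dev}\,D$ be the family of translates $D+g$, $g\in\mathbb{F}_q$. A family $\mathcal{B}$ of subsets (blocks) of a $v$-set $V$, counted with multiplicity, is a $2$-$(v,k,\mu)$ adesign if $\mu$ is a positive integer, every block has $k$ elements, every $2$-element subset of $V$ is contained in exactly $\mu$ or exactly $\mu+1$ blocks, and both values $\mu$ and $\mu+1$ occur. Let $C\subseteq\mathbb{F}_q$ satisfy one of the following: 1. $C=D_i^4\cup D_{i+1}^4$ for some $i$, $q\equiv 5\pmod 8$, and $q=s^2+4$ for an integer $s\equiv 1\pmod 4$; 2. $C=D_0^8\cup D_1^8\cup D_2^8\cup D_5^8$ and $q=l^2$, where $l$ is a prime power with $l\equiv 3\pmod 8$ and $l=t^2+2$ for an integer $t$; 3. $q=l^2$ for a prime power $l$, and $C=\bigcup_{i\in I}D_i^{l+1}$ for a set $I\subseteq\{0,1,\dots,l\}$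 with $|I|=\frac{l+1}{2}$ that contains both an even and an odd number. Then $\frac{q-1}{2}$ and $\frac{3q-11}{4}$ are integers, and the family of $3q$ blocks $\mathrm{Dev}\,D_0^2\cup\mathrm{Dev}\,D_1^2\cup\mathrm{Dev}\,C$ (union with multiplicities) is a $2$-$\left(q,\frac{q-1}{2},\frac{3q-11}{4}\right)$ adesign on $\mathbb{F}_q$. Moreover, these $3q$ blocks are pairwise distinct, except possibly when $q=5$, or when $q=9$ and $C$ is the set in (2). -/

import Mathlib

/-- The cyclotomic class `D_i^e = α^i ⟨α^e⟩` of order `e`, as a set of field elements. -/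
noncomputable def cyclotomicClass {F : Type*} [Field F] [Fintype F] (α : Fˣ) (e i : ℕ) :
    Finset F :=
  open Classical in
  Finset.univ.filter fun x : F => ∃ y ∈ Subgroup.zpowers (α ^ e), x = ((α ^ i * y : Fˣ) : F)

/-- The development of `D`: the family of its translates `D + g`, one for each `g`. -/
def development {G : Type*} [AddGroup G] [Fintype G] [DecidableEq G] (D : Finset G) :
    Multiset (Finset G) :=
  (Finset.univ : Finset G).val.map fun g => D.image (· + g)

/-- The number of blocks, counted with multiplicity, that contain all points of `T`. -/
def blockCount {V : Type*} [DecidableEq V] (B : Multiset (Finset V)) (T : Finset V) : ℕ :=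
  (B.filter fun b => T ⊆ b).card

/-- The incidence structure with blocks `B` has exactly the `t`-levels `L`: these are positive
integers, every `t`-set of points lies in `m` blocks for some `m ∈ L`, and every `m ∈ L` occurs. -/
structure HasLevels {V : Type*} [DecidableEq V] (t : ℕ) (B : Multiset (Finset V))
    (L : Finset ℕ) : Prop where
  pos : ∀ m ∈ L, 0 < m
  mem : ∀ T : Finset V, T.card = t → blockCount B T ∈ L
  attained : ∀ m ∈ L, ∃ T : Finset V, T.card = t ∧ blockCount B T = m

/-- `B` is the family of blocks of a `t-(v, k, μ)` adesign on the point set `V`. -/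
structure IsAdesign {V : Type*} [Fintype V] [DecidableEq V] (t v k μ : ℕ)
    (B : Multiset (Finset V)) : Prop where
  card_points : Fintype.card V = v
  card_block : ∀ b ∈ B, b.card = k
  levels : HasLevels t B {μ, μ + 1}

/-! Let q be the order of F and f the sign function of a set D of nonzero elements (`signFun`). If f
sums to 0, its autocorrelation at w ≠ 0 is 4d(w) - q + 2([w ∈ D] + [-w ∈ D]), where d(w) counts the
representations of w as a difference in D, hence the blocks of Dev D through a pair with difference
w. For the squares and the nonsquares f is ± the quadratic character, with autocorrelation -1, so
together they contribute the constant (q-3)/2. It remains to show that for C the count d takes only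
the values (q-5)/4 and (q-1)/4. Both then occur, because a constant d would equal (q-3)/4.

Case (1). f is Re + Im of a rotated quartic character χ, with autocorrelation -1 ± Im J(χ,χ). Here
|J|² = q, and J reduces, modulo a prime above p, to ± a binomial coefficient that is nonzero by
Lucas. So (Re J)² + (Im J)² = q is a primitive representation; uniqueness against q = s² + 4, and
parity, give Im J = ±2.

Case (3). Let K be the subfield of order l. C is a union of punctured K-lines. Writing the points
off Kw as a(τ+b)w turns translation by w into b ↦ b + 1/a, so the autocorrelation reduces to line
sums (`sum_mul_add_plane`). It is -1, and C = -C.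

Case (2). f = g + h, where g is K*-invariant and even, and h is odd and scaled by signs under K*.
The cross terms cancel; g is treated as in case (3), and the autocorrelation of h is governed by two
line sums N₁, N₂ with N₂² + 2N₁² = l. A power sum, again a binomial coefficient modulo p, shows that
this representation is primitive, so l = t² + 2 gives N₁² = 1.

Distinctness. Each base set is stable under some α^e ≠ 1, so its elements sum to 0; the element sum
of a block then reveals the translation. C differs from both quadratic classes because it has
exponents of both parities. -/

set_option linter.unusedSectionVars false

/-! ### Discrete logarithms, functions of the index, and multiplicative characters -/

section DiscreteLog

variable {F : Type*} [Field F]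

open Classical in
/-- The discrete logarithm of `x` to the base `α`, modulo `e` (and `0` where there is none). -/
noncomputable def ind (α : Fˣ) (e : ℕ) (x : F) : ZMod e :=
  if h : ∃ n : ℕ, x = (α : F) ^ n then (Nat.find h : ZMod e) else 0

variable {α : Fˣ} {e : ℕ}

/-- The function on `F` that vanishes at `0` and is `c` of the discrete logarithm elsewhere. -/
noncomputable def indFun {R : Type*} [Zero R] (α : Fˣ) (e : ℕ) (c : ZMod e → R) (x : F) : R :=
  open Classical in if x = 0 then 0 else c (ind α e x)

@[simp] theorem indFun_zero {R : Type*} [Zero R] (c : ZMod e → R) :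
    indFun α e c (0 : F) = 0 := by simp [indFun]

theorem indFun_of_ne {R : Type*} [Zero R] (c : ZMod e → R) {x : F} (hx : x ≠ 0) :
    indFun α e c x = c (ind α e x) := by simp [indFun, hx]

variable [Fintype F]

theorem orderOf_generator (hα : Subgroup.zpowers α = ⊤) : orderOf α = Fintype.card F - 1 := by
  classical
  rw [orderOf_eq_card_of_forall_mem_zpowers (fun x => by rw [hα]; trivial), Nat.card_eq_fintype_card,
    Fintype.card_units]

theorem exists_eq_pow (hα : Subgroup.zpowers α = ⊤) {x : F} (hx : x ≠ 0) :
    ∃ n : ℕ, x = (α : F) ^ n := by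
  have h : Units.mk0 x hx ∈ Subgroup.zpowers α := by rw [hα]; trivial
  obtain ⟨n, hn⟩ := (mem_powers_iff_mem_zpowers.mpr h)
  refine ⟨n, ?_⟩
  have := congrArg (fun u : Fˣ => (u : F)) hn
  simpa using this.symm

/-- Logarithms are unique modulo q - 1, so modulo a divisor e the choice made by `Nat.find` is
immaterial. -/
theorem ind_pow (hα : Subgroup.zpowers α = ⊤) (he : e ∣ Fintype.card F - 1) (n : ℕ) :
    ind α e ((α : F) ^ n) = n := by
  classical
  have h : ∃ m : ℕ, (α : F) ^ n = (α : F) ^ m := ⟨n, rfl⟩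
  rw [ind, dif_pos h]
  have h2 := Nat.find_spec h
  have h3 : α ^ n = α ^ (Nat.find h) := by
    ext; simpa using h2
  rw [pow_eq_pow_iff_modEq, orderOf_generator hα] at h3
  exact ((ZMod.natCast_eq_natCast_iff _ _ _).mpr (h3.of_dvd he)).symm

theorem ind_mul (hα : Subgroup.zpowers α = ⊤) (he : e ∣ Fintype.card F - 1) {x y : F}
    (hx : x ≠ 0) (hy : y ≠ 0) : ind α e (x * y) = ind α e x + ind α e y := by
  obtain ⟨m, rfl⟩ := exists_eq_pow hα hx
  obtain ⟨n, rfl⟩ := exists_eq_pow hα hy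
  rw [← pow_add, ind_pow hα he, ind_pow hα he, ind_pow hα he, Nat.cast_add]

theorem ind_one (hα : Subgroup.zpowers α = ⊤) (he : e ∣ Fintype.card F - 1) :
    ind α e (1 : F) = 0 := by
  simpa using ind_pow hα he 0

theorem ind_generator (hα : Subgroup.zpowers α = ⊤) (he : e ∣ Fintype.card F - 1) :
    ind α e (α : F) = 1 := by
  simpa using ind_pow hα he 1

theorem ind_pow_apply (hα : Subgroup.zpowers α = ⊤) (he : e ∣ Fintype.card F - 1) {x : F}
    (hx : x ≠ 0) (n : ℕ) : ind α e (x ^ n) = n * ind α e x := by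
  obtain ⟨m, rfl⟩ := exists_eq_pow hα hx
  rw [← pow_mul, ind_pow hα he, ind_pow hα he, Nat.cast_mul, mul_comm]

theorem mem_cyclotomicClass (hα : Subgroup.zpowers α = ⊤) (he : e ∣ Fintype.card F - 1) {i : ℕ}
    {x : F} : x ∈ cyclotomicClass α e i ↔ x ≠ 0 ∧ ind α e x = i := by
  classical
  simp only [cyclotomicClass, Finset.mem_filter, Finset.mem_univ, true_and]
  constructor
  · rintro ⟨y, hy, rfl⟩
    refine ⟨Units.ne_zero _, ?_⟩
    obtain ⟨n, rfl⟩ := mem_powers_iff_mem_zpowers.mpr hy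
    have : ((α ^ i * (fun x => (α ^ e) ^ x) n : Fˣ) : F) = (α : F) ^ (i + e * n) := by
      simp [pow_add, pow_mul]
    rw [this, ind_pow hα he]
    simp
  · rintro ⟨hx, h⟩
    obtain ⟨m, rfl⟩ := exists_eq_pow hα hx
    rw [ind_pow hα he, ZMod.natCast_eq_natCast_iff, Nat.modEq_iff_dvd] at h
    obtain ⟨c, hc⟩ := h
    refine ⟨(α ^ e) ^ (-c), Subgroup.zpow_mem _ (Subgroup.mem_zpowers _) _, ?_⟩
    have : α ^ i * (α ^ e) ^ (-c) = α ^ m := by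
      rw [← zpow_natCast α e, ← zpow_natCast α i, ← zpow_natCast α m, ← zpow_mul, ← zpow_add]
      congr 1; linarith
    rw [this]; simp

theorem zero_notMem_cyclotomicClass {i : ℕ} : (0 : F) ∉ cyclotomicClass α e i := by
  classical
  simp only [cyclotomicClass, Finset.mem_filter, Finset.mem_univ, true_and, not_exists, not_and]
  intro y _ h
  exact Units.ne_zero _ h.symm

theorem indFun_mul {R : Type*} [Zero R] (hα : Subgroup.zpowers α = ⊤)
    (he : e ∣ Fintype.card F - 1) (c : ZMod e → R) {x : F} (hx : x ≠ 0) (y : F) :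
    indFun α e c (x * y) = indFun α e (fun k => c (ind α e x + k)) y := by
  by_cases hy : y = 0
  · simp [hy]
  · rw [indFun_of_ne _ (mul_ne_zero hx hy), indFun_of_ne _ hy, ind_mul hα he hx hy]

theorem sum_mul_left_eq {R : Type*} [AddCommMonoid R] (f : F → R) {a : F} (ha : a ≠ 0) :
    ∑ x, f (a * x) = ∑ x, f x :=
  Fintype.sum_equiv (Equiv.mulLeft₀ a ha) _ _ fun _ => rfl

theorem neZero_of_dvd (he : e ∣ Fintype.card F - 1) : NeZero e := by
  have := Fintype.one_lt_card (α := F)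
  refine ⟨?_⟩
  rintro rfl
  rw [zero_dvd_iff] at he
  omega

/-- Multiplication by α^k permutes F and shifts c by k; summing over all shifts replaces c by its
total at every nonzero point. -/
theorem sum_indFun (hα : Subgroup.zpowers α = ⊤) (he : e ∣ Fintype.card F - 1) [NeZero e]
    (c : ZMod e → ℤ) :
    e * ∑ x : F, indFun α e c x = ((Fintype.card F : ℤ) - 1) * ∑ k, c k := by
  classical
  have h1 (k : ZMod e) : ∑ x : F, indFun α e (fun j => c (k + j)) x = ∑ x : F, indFun α e c x := by
    rw [← sum_mul_left_eq (indFun α e c) (a := (α : F) ^ k.val) (by simp)]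
    refine Finset.sum_congr rfl fun x _ => ?_
    rw [indFun_mul hα he _ (by simp), ind_pow hα he]
    simp
  have h2 : ∑ k : ZMod e, ∑ x : F, indFun α e (fun j => c (k + j)) x
      = e * ∑ x : F, indFun α e c x := by
    simp [h1]
  rw [← h2, Finset.sum_comm]
  have h3 (x : F) : ∑ k : ZMod e, indFun α e (fun j => c (k + j)) x
      = if x = 0 then 0 else ∑ k, c k := by
    split_ifs with hx
    · simp [hx]
    · simp only [indFun_of_ne _ hx]
      exact Fintype.sum_equiv (Equiv.addRight (ind α e x)) _ _ fun _ => rfl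
  rw [Finset.sum_congr rfl fun x _ => h3 x, Finset.sum_ite]
  simp only [Finset.sum_const_zero, zero_add, Finset.sum_const, nsmul_eq_mul]
  congr 1
  have : Finset.univ.filter (fun x : F => ¬ x = 0) = Finset.univ.erase 0 := by
    ext; simp
  rw [this, Finset.card_erase_of_mem (Finset.mem_univ _), Finset.card_univ,
    Nat.cast_sub Fintype.card_pos]
  simp

/-- The multiplicative character that sends the generator `α` to the root of unity `ζ`. -/
noncomputable def indChar {R : Type*} [CommRing R] (hα : Subgroup.zpowers α = ⊤)
    (he : e ∣ Fintype.card F - 1) {ζ : R} (hζ : ζ ^ e = 1) : MulChar F R where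
  toFun := indFun α e fun k => ζ ^ k.val
  map_one' := by
    rw [indFun_of_ne _ one_ne_zero, ind_one hα he]; simp
  map_mul' x y := by
    have := neZero_of_dvd he
    by_cases hx : x = 0
    · simp [hx]
    by_cases hy : y = 0
    · simp [hy]
    rw [indFun_of_ne _ (mul_ne_zero hx hy), indFun_of_ne _ hy, indFun_of_ne _ hx,
      ind_mul hα he hx hy, ← pow_add, ZMod.val_add]
    exact (pow_eq_pow_mod _ hζ).symm
  map_nonunit' x hx := by
    have : x = 0 := by simpa using hx
    simp [this]

theorem indChar_apply {R : Type*} [CommRing R] (hα : Subgroup.zpowers α = ⊤)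
    (he : e ∣ Fintype.card F - 1) {ζ : R} (hζ : ζ ^ e = 1) (x : F) :
    indChar hα he hζ x = indFun α e (fun k => ζ ^ k.val) x := rfl

theorem indChar_pow {R : Type*} [CommRing R] (hα : Subgroup.zpowers α = ⊤)
    (he : e ∣ Fintype.card F - 1) {ζ : R} (hζ : ζ ^ e = 1) (n : ℕ) :
    indChar hα he hζ ((α : F) ^ n) = ζ ^ n := by
  rw [indChar_apply, indFun_of_ne _ (by simp), ind_pow hα he, ZMod.val_natCast,
    ← pow_eq_pow_mod n hζ]

/-- The correlation of two multiplicative characters is a Jacobi sum. -/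
theorem sum_mulChar_mul_mulChar_add {R : Type*} [CommRing R] (χ φ : MulChar F R) {w : F}
    (hw : w ≠ 0) :
    ∑ x, χ x * φ (x + w) = χ (-1) * (χ w * φ w) * jacobiSum χ φ := by
  -- The substitution x ↦ -w x turns x + w into w(1 - x).
  rw [← sum_mul_left_eq _ (neg_ne_zero.mpr hw), jacobiSum, Finset.mul_sum]
  refine Finset.sum_congr rfl fun x _ => ?_
  have h1 : -w * x = (-1) * (w * x) := by ring
  have h2 : (-1) * (w * x) + w = w * (1 - x) := by ring
  rw [h1, h2, map_mul, map_mul, map_mul]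
  ring

theorem sum_mulChar_mul_inv_add {R : Type*} [CommRing R] [IsDomain R] {χ : MulChar F R}
    (hχ : χ ≠ 1) {w : F} (hw : w ≠ 0) : ∑ x, χ x * χ⁻¹ (x + w) = -1 := by
  rw [sum_mulChar_mul_mulChar_add _ _ hw, jacobiSum_nontrivial_inv hχ]
  have h1 : χ w * χ⁻¹ w = 1 := by
    rw [← MulChar.mul_apply, mul_inv_cancel, MulChar.one_apply hw.isUnit]
  have h2 : χ (-1) * χ (-1) = 1 := by
    rw [← map_mul]; simp
  rw [h1]
  linear_combination -h2

end DiscreteLog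

/-! ### Difference counts and autocorrelation of sign functions -/

section Differences

variable {F : Type*} [Field F] [Fintype F] [DecidableEq F]

/-- The number of ways to write `w` as a difference of two elements of `D`. -/
def diffCount (D : Finset F) (w : F) : ℕ :=
  (Finset.univ.filter fun x => x ∈ D ∧ x + w ∈ D).card

theorem mem_image_add {D : Finset F} {g x : F} : x ∈ D.image (· + g) ↔ x - g ∈ D := by
  simp only [Finset.mem_image]
  constructor
  · rintro ⟨a, ha, rfl⟩; simpa using ha
  · intro h; exact ⟨_, h, by ring⟩

theorem card_image_add (D : Finset F) (g : F) : (D.image (· + g)).card = D.card :=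
  Finset.card_image_of_injective _ (add_left_injective g)

theorem blockCount_development (D : Finset F) (x y : F) :
    blockCount (development D) {x, y} = diffCount D (y - x) := by
  rw [blockCount, development, Multiset.filter_map, Multiset.card_map, diffCount]
  change (Finset.univ.filter _).card = _
  refine Finset.card_bij' (fun g _ => x - g) (fun a _ => x - a) ?_ ?_ ?_ ?_
  · intro g hg
    simp only [Function.comp, Finset.mem_filter, Finset.mem_univ, true_and, Finset.insert_subset_iff,
      Finset.singleton_subset_iff, mem_image_add] at hg ⊢
    exact ⟨hg.1, by rw [show x - g + (y - x) = y - g by ring]; exact hg.2⟩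
  · intro a ha
    simp only [Function.comp, Finset.mem_filter, Finset.mem_univ, true_and, Finset.insert_subset_iff,
      Finset.singleton_subset_iff, mem_image_add] at ha ⊢
    refine ⟨by simpa using ha.1, ?_⟩
    rw [show y - (x - a) = a + (y - x) by ring]; exact ha.2
  · intro g _; simp
  · intro g _; simp

theorem blockCount_add {V : Type*} [DecidableEq V] (A B : Multiset (Finset V)) (T : Finset V) :
    blockCount (A + B) T = blockCount A T + blockCount B T := by
  simp [blockCount]

/-- The function that is `1` on `D`, `-1` on the other nonzero elements, and `0` at `0`. -/
def signFun (D : Finset F) (x : F) : ℤ := if x = 0 then 0 else if x ∈ D then 1 else -1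

theorem signFun_eq {D : Finset F} (h0 : (0 : F) ∉ D) (x : F) :
    signFun D x = 2 * (if x ∈ D then 1 else 0) - 1 + if x = 0 then 1 else 0 := by
  unfold signFun
  by_cases hx : x = 0
  · simp [hx, h0]
  · by_cases hD : x ∈ D <;> simp [hx, hD]

theorem two_mul_card_of_sum_signFun {D : Finset F} (h0 : (0 : F) ∉ D)
    (hs : ∑ x, signFun D x = 0) : 2 * D.card + 1 = Fintype.card F := by
  simp only [signFun_eq h0, Finset.sum_add_distrib, Finset.sum_sub_distrib, ← Finset.mul_sum] at hs
  simp at hs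
  omega

/-- Expand the sign function as 2·1_D - 1 + δ₀; the cross terms of δ₀ with 1_D record whether w and
-w lie in D. -/
theorem sum_signFun_mul {D : Finset F} (h0 : (0 : F) ∉ D) (hs : ∑ x, signFun D x = 0) {w : F}
    (hw : w ≠ 0) :
    ∑ x, signFun D x * signFun D (x + w) = 4 * diffCount D w - Fintype.card F
      + 2 * ((if w ∈ D then 1 else 0) + if -w ∈ D then 1 else 0) := by
  have hc := two_mul_card_of_sum_signFun h0 hs
  have hS : ∑ x : F, (if x ∈ D then (1 : ℤ) else 0) = D.card := by simp
  have hS' : ∑ x : F, (if x + w ∈ D then (1 : ℤ) else 0) = D.card := by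
    rw [← hS]
    exact Fintype.sum_equiv (Equiv.addRight w) _ _ fun _ => rfl
  have hd : ∑ x : F, (if x ∈ D then (1 : ℤ) else 0) * (if x + w ∈ D then 1 else 0)
      = diffCount D w := by
    rw [diffCount, Finset.card_filter]
    push_cast
    refine Finset.sum_congr rfl fun x _ => ?_
    by_cases h1 : x ∈ D <;> by_cases h2 : x + w ∈ D <;> simp [h1, h2]
  have e1 : ∑ x : F, (if x ∈ D then (1 : ℤ) else 0) * (if x + w = 0 then 1 else 0)
      = if -w ∈ D then 1 else 0 := by
    rw [Finset.sum_eq_single (-w)]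
    · simp
    · intro b _ hb
      have : b + w ≠ 0 := fun h => hb (eq_neg_of_add_eq_zero_left h)
      simp [this]
    · simp
  have e2 : ∑ x : F, (if x = 0 then (1 : ℤ) else 0) * (if x + w ∈ D then 1 else 0)
      = if w ∈ D then 1 else 0 := by
    rw [Finset.sum_eq_single 0] <;> simp +contextual
  have e3 : ∑ x : F, (if x = 0 then (1 : ℤ) else 0) * (if x + w = 0 then 1 else 0) = 0 := by
    rw [Finset.sum_eq_single 0] <;> simp +contextual [hw]
  have e4 : ∑ x : F, (if x + w = 0 then (1 : ℤ) else 0) = 1 := by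
    rw [Finset.sum_eq_single (-w)]
    · simp
    · intro b _ hb
      have : b + w ≠ 0 := fun h => hb (eq_neg_of_add_eq_zero_left h)
      simp [this]
    · simp
  have e5 : ∑ x : F, (if x = 0 then (1 : ℤ) else 0) = 1 := by simp
  have key (x : F) : signFun D x * signFun D (x + w) =
      4 * ((if x ∈ D then (1 : ℤ) else 0) * (if x + w ∈ D then 1 else 0))
      - 2 * (if x ∈ D then (1 : ℤ) else 0) - 2 * (if x + w ∈ D then (1 : ℤ) else 0)
      + 2 * ((if x ∈ D then (1 : ℤ) else 0) * (if x + w = 0 then 1 else 0))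
      + 2 * ((if x = 0 then (1 : ℤ) else 0) * (if x + w ∈ D then 1 else 0))
      + (if x = 0 then (1 : ℤ) else 0) * (if x + w = 0 then 1 else 0)
      - (if x = 0 then (1 : ℤ) else 0) - (if x + w = 0 then (1 : ℤ) else 0) + 1 := by
    rw [signFun_eq h0, signFun_eq h0]; ring
  simp only [key, Finset.sum_add_distrib, Finset.sum_sub_distrib, ← Finset.mul_sum, hS, hS', hd, e1,
    e2, e3, e4, e5]
  simp only [Finset.sum_const, Finset.card_univ, nsmul_eq_mul]
  push_cast [← hc]
  ring

theorem sum_diffCount (D : Finset F) : ∑ w, diffCount D w = D.card * D.card := by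
  have (w : F) : diffCount D w = ∑ x : F, if x ∈ D then (if x + w ∈ D then 1 else 0) else 0 := by
    rw [diffCount, Finset.card_filter]
    refine Finset.sum_congr rfl fun x _ => ?_
    by_cases h1 : x ∈ D <;> by_cases h2 : x + w ∈ D <;> simp [h1, h2]
  simp only [this]
  rw [Finset.sum_comm]
  have h2 (x : F) : ∑ w : F, (if x ∈ D then (if x + w ∈ D then 1 else 0) else 0)
      = if x ∈ D then D.card else 0 := by
    by_cases h : x ∈ D
    · have := Fintype.sum_equiv (Equiv.addLeft x) (fun y => if x + y ∈ D then 1 else 0)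
        (fun y => if y ∈ D then 1 else 0) fun _ => rfl
      simp only [h, if_true, this]
      simp
    · simp [h]
  simp [h2]

theorem diffCount_zero (D : Finset F) : diffCount D 0 = D.card := by
  simp [diffCount]

/-- If the nonzero values of `diffCount` are among `(q - 5) / 4` and `(q - 1) / 4`, both occur. -/
theorem exists_diffCount_eq {D : Finset F} (hc : 2 * D.card + 1 = Fintype.card F)
    (hd : ∀ w, w ≠ 0 → 4 * diffCount D w + 5 = Fintype.card F ∨
      4 * diffCount D w + 1 = Fintype.card F) :
    (∃ w, w ≠ 0 ∧ 4 * diffCount D w + 5 = Fintype.card F) ∧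
      ∃ w, w ≠ 0 ∧ 4 * diffCount D w + 1 = Fintype.card F := by
  have h1 := sum_diffCount D
  rw [← Finset.add_sum_erase _ _ (Finset.mem_univ (0 : F)), diffCount_zero] at h1
  have hcard : (Finset.univ.erase (0 : F)).card = 2 * D.card := by
    rw [Finset.card_erase_of_mem (Finset.mem_univ _), Finset.card_univ]; omega
  have hpos : 0 < D.card := by
    have := Fintype.one_lt_card (α := F); omega
  -- A constant value n gives |D| + 2|D|n = |D|², that is q = 4n + 3.
  have aux (n : ℕ) (h : ∀ w : F, w ≠ 0 → diffCount D w = n) : 2 * n + 1 = D.card := by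
    rw [Finset.sum_congr rfl fun w hw => h w (Finset.ne_of_mem_erase hw), Finset.sum_const, hcard,
      smul_eq_mul] at h1
    nlinarith
  constructor
  · by_contra! hn
    have h2 (w : F) (hw : w ≠ 0) : 4 * diffCount D w + 1 = Fintype.card F :=
      (hd w hw).resolve_left (hn w hw)
    have := h2 1 one_ne_zero
    have := aux (diffCount D 1) fun w hw => by have := h2 w hw; omega
    omega
  · by_contra! hn
    have h2 (w : F) (hw : w ≠ 0) : 4 * diffCount D w + 5 = Fintype.card F :=
      (hd w hw).resolve_right (hn w hw)
    have := h2 1 one_ne_zero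
    have := aux (diffCount D 1) fun w hw => by have := h2 w hw; omega
    omega

end Differences

/-! ### Squares and nonsquares -/

section Paley

variable {F : Type*} [Field F] [Fintype F] [DecidableEq F] {α : Fˣ}

theorem zmod_two_cases (x : ZMod 2) : x = 0 ∨ x = 1 := by
  revert x; decide

theorem signFun_cyclotomicClass_two (hα : Subgroup.zpowers α = ⊤) (h2 : 2 ∣ Fintype.card F - 1)
    {i : ℕ} (x : F) :
    signFun (cyclotomicClass α 2 i) x
      = (-1) ^ i * indChar (R := ℤ) hα h2 (ζ := -1) (by norm_num) x := by
  by_cases hx : x = 0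
  · simp [signFun, hx, indChar_apply]
  · simp only [signFun, hx, mem_cyclotomicClass hα h2, if_false, indChar_apply, indFun_of_ne _ hx,
      ne_eq, not_false_eq_true, true_and]
    rcases Nat.even_or_odd i with hi | hi
    · have : (i : ZMod 2) = 0 := (ZMod.natCast_eq_zero_iff_even).mpr hi
      rw [this, hi.neg_one_pow]
      rcases zmod_two_cases (ind α 2 x) with h | h <;> rw [h] <;> decide
    · have : (i : ZMod 2) = 1 := (ZMod.natCast_eq_one_iff_odd).mpr hi
      rw [this, hi.neg_one_pow]
      rcases zmod_two_cases (ind α 2 x) with h | h <;> rw [h] <;> decide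

theorem indChar_neg_one_ne_one (hα : Subgroup.zpowers α = ⊤) (h2 : 2 ∣ Fintype.card F - 1) :
    indChar (R := ℤ) hα h2 (ζ := -1) (by norm_num) ≠ 1 := by
  intro h
  have h3 := indChar_pow (R := ℤ) hα h2 (ζ := -1) (by norm_num) 1
  rw [h, pow_one, MulChar.one_apply_coe] at h3
  norm_num at h3

theorem sum_signFun_cyclotomicClass_two (hα : Subgroup.zpowers α = ⊤)
    (h2 : 2 ∣ Fintype.card F - 1) (i : ℕ) : ∑ x, signFun (cyclotomicClass α 2 i) x = 0 := by
  simp only [signFun_cyclotomicClass_two hα h2, ← Finset.mul_sum]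
  rw [MulChar.sum_eq_zero_of_ne_one (indChar_neg_one_ne_one hα h2), mul_zero]

theorem indChar_neg_one_inv (hα : Subgroup.zpowers α = ⊤) (h2 : 2 ∣ Fintype.card F - 1) :
    (indChar (R := ℤ) hα h2 (ζ := -1) (by norm_num))⁻¹ =
      indChar (R := ℤ) hα h2 (ζ := -1) (by norm_num) := by
  rw [inv_eq_iff_mul_eq_one]
  ext u
  rw [MulChar.mul_apply, MulChar.one_apply_coe, indChar_apply, indFun_of_ne _ u.ne_zero, ← mul_pow]
  norm_num

theorem sum_signFun_mul_cyclotomicClass_two (hα : Subgroup.zpowers α = ⊤)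
    (h2 : 2 ∣ Fintype.card F - 1) (i : ℕ) {w : F} (hw : w ≠ 0) :
    ∑ x, signFun (cyclotomicClass α 2 i) x * signFun (cyclotomicClass α 2 i) (x + w) = -1 := by
  rw [← sum_mulChar_mul_inv_add (indChar_neg_one_ne_one hα h2) hw]
  refine Finset.sum_congr rfl fun x _ => ?_
  rw [signFun_cyclotomicClass_two hα h2, signFun_cyclotomicClass_two hα h2,
    indChar_neg_one_inv hα h2]
  have : ((-1 : ℤ) ^ i) * (-1) ^ i = 1 := by rw [← mul_pow]; norm_num
  linear_combination (indChar (R := ℤ) hα h2 (ζ := -1) (by norm_num) x *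
    indChar (R := ℤ) hα h2 (ζ := -1) (by norm_num) (x + w)) * this

theorem mem_cyclotomicClass_two_zero_or_one (hα : Subgroup.zpowers α = ⊤)
    (h2 : 2 ∣ Fintype.card F - 1) {w : F} (hw : w ≠ 0) :
    (w ∈ cyclotomicClass α 2 0 ∧ w ∉ cyclotomicClass α 2 1) ∨
      (w ∉ cyclotomicClass α 2 0 ∧ w ∈ cyclotomicClass α 2 1) := by
  simp only [mem_cyclotomicClass hα h2, hw, ne_eq, not_false_eq_true, true_and]
  rcases zmod_two_cases (ind α 2 w) with h | h <;> rw [h] <;> decide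

/-- Each of w and -w lies in exactly one of the two classes, so the membership terms add up to a
constant. -/
theorem diffCount_cyclotomicClass_two (hα : Subgroup.zpowers α = ⊤)
    (h2 : 2 ∣ Fintype.card F - 1) {w : F} (hw : w ≠ 0) :
    2 * (diffCount (cyclotomicClass α 2 0) w + diffCount (cyclotomicClass α 2 1) w) + 3
      = Fintype.card F := by
  have a0 := sum_signFun_mul zero_notMem_cyclotomicClass
    (sum_signFun_cyclotomicClass_two hα h2 0) hw
  have a1 := sum_signFun_mul zero_notMem_cyclotomicClass
    (sum_signFun_cyclotomicClass_two hα h2 1) hw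
  rw [sum_signFun_mul_cyclotomicClass_two hα h2 _ hw] at a0 a1
  have b1 := mem_cyclotomicClass_two_zero_or_one hα h2 hw
  have b2 := mem_cyclotomicClass_two_zero_or_one hα h2 (neg_ne_zero.mpr hw)
  rcases b1 with ⟨c1, c2⟩ | ⟨c1, c2⟩ <;> rcases b2 with ⟨c3, c4⟩ | ⟨c3, c4⟩ <;>
    simp only [c1, c2, c3, c4, if_true, if_false] at a0 a1 <;> omega

end Paley

/-! ### From difference levels to the adesign, and distinctness of blocks -/

section Adesign

variable {F : Type*} [Field F] [Fintype F] [DecidableEq F] {α : Fˣ}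

theorem card_of_mem_development {D b : Finset F} (hb : b ∈ development D) : b.card = D.card := by
  rw [development, Multiset.mem_map] at hb
  obtain ⟨g, _, rfl⟩ := hb
  exact card_image_add D g

/-- A set with two difference levels `(q - 5) / 4`, `(q - 1) / 4` extends the developments of the
squares and of the nonsquares to an adesign. -/
theorem isAdesign_development (hα : Subgroup.zpowers α = ⊤) (h4 : 4 ∣ Fintype.card F - 1)
    {C : Finset F} (h0 : (0 : F) ∉ C) (hs : ∑ x, signFun C x = 0)
    (hd : ∀ w, w ≠ 0 → 4 * diffCount C w + 5 = Fintype.card F ∨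
      4 * diffCount C w + 1 = Fintype.card F) :
    ∃ k μ : ℕ, 2 * k + 1 = Fintype.card F ∧ 4 * μ + 11 = 3 * Fintype.card F ∧
      IsAdesign 2 (Fintype.card F) k μ
        (development (cyclotomicClass α 2 0) + development (cyclotomicClass α 2 1) +
          development C) := by
  have h2 : 2 ∣ Fintype.card F - 1 := dvd_trans (by norm_num) h4
  have h1 := Fintype.one_lt_card (α := F)
  have hc := two_mul_card_of_sum_signFun h0 hs
  have hc0 := two_mul_card_of_sum_signFun zero_notMem_cyclotomicClass
    (sum_signFun_cyclotomicClass_two hα h2 0)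
  have hc1 := two_mul_card_of_sum_signFun zero_notMem_cyclotomicClass
    (sum_signFun_cyclotomicClass_two hα h2 1)
  obtain ⟨⟨w₁, hw₁, e₁⟩, w₂, hw₂, e₂⟩ := exists_diffCount_eq hc hd
  obtain ⟨m, hm⟩ := h4
  have hbc (x y : F) : blockCount (development (cyclotomicClass α 2 0) +
      development (cyclotomicClass α 2 1) + development C) {x, y} =
      diffCount (cyclotomicClass α 2 0) (y - x) + diffCount (cyclotomicClass α 2 1) (y - x) +
      diffCount C (y - x) := by
    rw [blockCount_add, blockCount_add, blockCount_development, blockCount_development,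
      blockCount_development]
  -- With q = 4m + 1, (3q - 11)/4 = 3m - 2; q > 1 makes m positive.
  refine ⟨C.card, 3 * m - 2, hc, by omega, rfl, ?_, ?_, ?_, ?_⟩
  · intro b hb
    rw [Multiset.mem_add, Multiset.mem_add] at hb
    rcases hb with (hb | hb) | hb <;> rw [card_of_mem_development hb] <;> omega
  · intro n hn
    simp only [Finset.mem_insert, Finset.mem_singleton] at hn
    omega
  · intro T hT
    obtain ⟨x, y, hxy, rfl⟩ := Finset.card_eq_two.mp hT
    have hw : y - x ≠ 0 := sub_ne_zero.mpr hxy.symm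
    have := diffCount_cyclotomicClass_two hα h2 hw
    simp only [hbc, Finset.mem_insert, Finset.mem_singleton]
    rcases hd _ hw with h | h <;> omega
  · intro n hn
    simp only [Finset.mem_insert, Finset.mem_singleton] at hn
    rcases hn with hn | hn
    · refine ⟨{0, w₁}, Finset.card_pair hw₁.symm, ?_⟩
      have := diffCount_cyclotomicClass_two hα h2 hw₁
      rw [hbc, sub_zero]; omega
    · refine ⟨{0, w₂}, Finset.card_pair hw₂.symm, ?_⟩
      have := diffCount_cyclotomicClass_two hα h2 hw₂
      rw [hbc, sub_zero]; omega

theorem sum_image_add (D : Finset F) (g : F) :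
    ∑ x ∈ D.image (· + g), x = ∑ x ∈ D, x + D.card * g := by
  rw [Finset.sum_image (fun a _ b _ h => add_left_injective g h), Finset.sum_add_distrib]
  simp

theorem card_ne_zero_of_two_mul_card {D : Finset F} (hc : 2 * D.card + 1 = Fintype.card F) :
    (D.card : F) ≠ 0 := by
  intro h
  have := congrArg (fun n : ℕ => (n : F)) hc
  simp [h] at this

/-- Translation by g adds |D|g to the sum of the elements, and |D| is invertible in F because 2|D| +
1 = q = 0 there. -/
theorem nodup_development {D : Finset F} (hc : 2 * D.card + 1 = Fintype.card F) :
    (development D).Nodup := by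
  refine Multiset.Nodup.map ?_ Finset.univ.nodup
  intro g h hgh
  have := congrArg (fun s : Finset F => ∑ x ∈ s, x) hgh
  simp only [sum_image_add, add_right_inj] at this
  exact mul_left_cancel₀ (card_ne_zero_of_two_mul_card hc) this

theorem disjoint_development {D E : Finset F} (hD : 2 * D.card + 1 = Fintype.card F)
    (hE : 2 * E.card + 1 = Fintype.card F) (sD : ∑ x ∈ D, x = 0) (sE : ∑ x ∈ E, x = 0)
    (hne : D ≠ E) : Disjoint (development D) (development E) := by
  rw [Multiset.disjoint_left]
  intro b hb hb'
  rw [development, Multiset.mem_map] at hb hb'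
  obtain ⟨g, _, rfl⟩ := hb
  obtain ⟨h, _, e⟩ := hb'
  have hcard : E.card = D.card := by omega
  have := congrArg (fun s : Finset F => ∑ x ∈ s, x) e
  simp only [sum_image_add, sD, sE, zero_add, hcard] at this
  have hgh := mul_left_cancel₀ (card_ne_zero_of_two_mul_card hD) this
  subst hgh
  exact hne (Finset.image_injective (add_left_injective h) e).symm

/-- Multiplication by β permutes D, so the sum S of D satisfies S = βS. -/
theorem sum_eq_zero_of_mul_mem {D : Finset F} {β : F} (hβ0 : β ≠ 0) (hβ : β ≠ 1)
    (h : ∀ x, β * x ∈ D ↔ x ∈ D) : ∑ x ∈ D, x = 0 := by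
  have h1 : ∑ x ∈ D, x = ∑ x : F, if x ∈ D then x else 0 := by simp
  have h2 : ∑ x ∈ D, x = β * ∑ x ∈ D, x := by
    conv_lhs => rw [h1, ← sum_mul_left_eq _ hβ0]
    rw [h1, Finset.mul_sum]
    refine Finset.sum_congr rfl fun x _ => ?_
    simp [h]
  have h3 : (β - 1) * ∑ x ∈ D, x = 0 := by linear_combination -h2
  exact (mul_eq_zero.mp h3).resolve_left (sub_ne_zero.mpr hβ)

theorem generator_pow_ne_one (hα : Subgroup.zpowers α = ⊤) {e : ℕ} (h0 : 0 < e)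
    (he : e < Fintype.card F - 1) : (α : F) ^ e ≠ 1 := by
  intro h
  have h1 : α ^ e = 1 := by ext; simpa using h
  have := Nat.le_of_dvd h0 (orderOf_dvd_of_pow_eq_one h1)
  rw [orderOf_generator hα] at this
  omega

theorem generator_pow_mul_mem (hα : Subgroup.zpowers α = ⊤) {e : ℕ}
    (he : e ∣ Fintype.card F - 1) {i : ℕ} (x : F) :
    (α : F) ^ e * x ∈ cyclotomicClass α e i ↔ x ∈ cyclotomicClass α e i := by
  rw [mem_cyclotomicClass hα he, mem_cyclotomicClass hα he]
  by_cases hx : x = 0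
  · simp [hx]
  · rw [ind_mul hα he (by simp) hx, ind_pow hα he]
    simp

theorem nodup_development_add (hα : Subgroup.zpowers α = ⊤) (h4 : 4 ∣ Fintype.card F - 1)
    {C : Finset F} (h0 : (0 : F) ∉ C) (hs : ∑ x, signFun C x = 0) (hC : ∑ x ∈ C, x = 0)
    (hC0 : C ≠ cyclotomicClass α 2 0) (hC1 : C ≠ cyclotomicClass α 2 1) :
    (development (cyclotomicClass α 2 0) + development (cyclotomicClass α 2 1) +
      development C).Nodup := by
  have h2 : 2 ∣ Fintype.card F - 1 := dvd_trans (by norm_num) h4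
  have h1 := Fintype.one_lt_card (α := F)
  have hc := two_mul_card_of_sum_signFun h0 hs
  have hc0 := two_mul_card_of_sum_signFun zero_notMem_cyclotomicClass
    (sum_signFun_cyclotomicClass_two hα h2 0)
  have hc1 := two_mul_card_of_sum_signFun zero_notMem_cyclotomicClass
    (sum_signFun_cyclotomicClass_two hα h2 1)
  have h5 : 2 < Fintype.card F - 1 := by omega
  have s (i : ℕ) : ∑ x ∈ cyclotomicClass α 2 i, x = 0 :=
    sum_eq_zero_of_mul_mem (by simp) (generator_pow_ne_one hα two_pos h5)
      (generator_pow_mul_mem hα h2)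
  have hne : cyclotomicClass α 2 0 ≠ cyclotomicClass α 2 1 := by
    intro h
    have := mem_cyclotomicClass_two_zero_or_one hα h2 (one_ne_zero (α := F))
    rw [h] at this
    tauto
  rw [Multiset.nodup_add, Multiset.nodup_add, Multiset.disjoint_add_left]
  exact ⟨⟨nodup_development hc0, nodup_development hc1,
    disjoint_development hc0 hc1 (s 0) (s 1) hne⟩, nodup_development hc,
    disjoint_development hc0 hc (s 0) hC hC0.symm, disjoint_development hc1 hc (s 1) hC hC1.symm⟩

end Adesign

/-! ### A field as a plane over a subfield -/

section Plane

variable {F : Type*} [Field F] [Fintype F] [DecidableEq F] (K : Subfield F) [Fintype K] {τ : F}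

variable {K} in
theorem add_ne_zero_of_notMem (hτ : τ ∉ K) (b : K) : τ + b ≠ 0 := by
  intro h
  apply hτ
  rw [eq_neg_of_add_eq_zero_left h]
  exact K.neg_mem b.2

variable {K} in
-- Since τ and 1 are independent over K, F is the line Kw together with the points a(τ + b)w, a ≠ 0;
-- injectivity and counting suffice.
theorem bijective_plane (hτ : τ ∉ K) (hcard : Fintype.card F = Fintype.card K ^ 2) {w : F}
    (hw : w ≠ 0) :
    Function.Bijective fun p : K × K =>
      if p.1 = 0 then (p.2 : F) * w else (p.1 : F) * ((τ + p.2) * w) := by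
  rw [Fintype.bijective_iff_injective_and_card]
  refine ⟨?_, by rw [Fintype.card_prod, hcard, sq]⟩
  have key (a b c : K) (ha : a ≠ 0) (h : (a : F) * ((τ + b) * w) = c * w) : False := by
    have h1 : (a : F) * (τ + b) = c := mul_right_cancel₀ hw (by rw [mul_assoc]; exact h)
    have ha' : (a : F) ≠ 0 := by simpa using ha
    apply hτ
    have : τ = (a : F)⁻¹ * c - b := by rw [← h1]; field_simp; ring
    rw [this]
    exact K.sub_mem (K.mul_mem (K.inv_mem a.2) c.2) b.2
  rintro ⟨a, b⟩ ⟨c, d⟩ h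
  simp only at h
  split_ifs at h with h1 h2 h2
  · subst h1; subst h2
    have := mul_right_cancel₀ hw h
    simpa using this
  · exact (key _ _ _ h2 h.symm).elim
  · exact (key _ _ _ h1 h).elim
  · by_cases hac : a = c
    · subst hac
      have h3 : (a : F) ≠ 0 := by simpa using h1
      have := mul_right_cancel₀ hw (mul_left_cancel₀ h3 h)
      simpa using this
    · exfalso
      have h3 : (a : F) * (τ + b) = c * (τ + d) :=
        mul_right_cancel₀ hw (by rw [mul_assoc, mul_assoc]; exact h)
      have h4 : (a : F) - c ≠ 0 := by
        rw [sub_ne_zero]; simpa using hac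
      apply hτ
      have : τ = ((a : F) - c)⁻¹ * (c * d - a * b) := by
        field_simp; linear_combination h3
      rw [this]
      exact K.mul_mem (K.inv_mem (K.sub_mem a.2 c.2)) (K.sub_mem (K.mul_mem c.2 d.2)
        (K.mul_mem a.2 b.2))

variable {K} in
/-- The sum over `F` along the line `K w` and the punctured lines `K (τ + b) w`. -/
theorem sum_plane {M : Type*} [AddCommMonoid M] (hτ : τ ∉ K)
    (hcard : Fintype.card F = Fintype.card K ^ 2) {w : F} (hw : w ≠ 0) (f : F → M) :
    ∑ x, f x = ∑ b : K, f (b * w) +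
      ∑ a ∈ Finset.univ.erase (0 : K), ∑ b : K, f (a * ((τ + b) * w)) := by
  rw [← (bijective_plane hτ hcard hw).sum_comp f, Fintype.sum_prod_type,
    ← Finset.add_sum_erase _ _ (Finset.mem_univ (0 : K))]
  congr 1
  · simp
  · refine Finset.sum_congr rfl fun a ha => ?_
    simp [Finset.ne_of_mem_erase ha]

theorem sum_erase_inv {M : Type*} [AddCommMonoid M] (f : K → M) :
    ∑ a ∈ Finset.univ.erase (0 : K), f a⁻¹ = ∑ a ∈ Finset.univ.erase (0 : K), f a := by
  refine Finset.sum_bij' (fun a _ => a⁻¹) (fun a _ => a⁻¹) ?_ ?_ ?_ ?_ ?_ <;> simp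

variable {K} {f : F → ℤ} {ε : K → ℤ}

/-- For b ≠ 0, bw + w = b(1 + b⁻¹)w, and the sign ε b enters twice; inverting b leaves a sum along
the line without one term. -/
theorem sum_line_mul (h0 : f 0 = 0) (hε : ∀ a : K, a ≠ 0 → ε a * ε a = 1)
    (hf : ∀ (a : K) (x : F), a ≠ 0 → f (a * x) = ε a * f x) (w : F) :
    ∑ b : K, f (b * w) * f (b * w + w) = f w * ∑ b : K, f (b * w) - f w ^ 2 := by
  have h1 : ∑ b ∈ Finset.univ.erase (0 : K), f (b * w) * f (b * w + w)
      = ∑ b ∈ Finset.univ.erase (0 : K), f w * f ((1 + (b⁻¹ : K)) * w) := by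
    refine Finset.sum_congr rfl fun b hb => ?_
    have hb := Finset.ne_of_mem_erase hb
    have hb' : (b : F) ≠ 0 := by simpa using hb
    have : (b : F) * w + w = b * ((1 + (b⁻¹ : K)) * w) := by
      push_cast; field_simp
    rw [this, hf _ _ hb, hf _ _ hb]
    linear_combination f w * f ((1 + (b⁻¹ : K)) * w) * hε b hb
  rw [sum_erase_inv K fun b => f w * f ((1 + b) * w)] at h1
  rw [← Finset.add_sum_erase _ _ (Finset.mem_univ (0 : K)), h1]
  have h2 : ∑ b : K, f (b * w) = ∑ b : K, f ((1 + b) * w) := by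
    rw [← Fintype.sum_equiv (Equiv.addLeft (1 : K)) (fun b => f ((1 + b) * w)) _ fun b => ?_]
    simp
  rw [h2, ← Finset.add_sum_erase _ _ (Finset.mem_univ (0 : K)), ← Finset.mul_sum]
  simp [h0]
  ring

theorem sum_sq_plane (hτ : τ ∉ K) (hcard : Fintype.card F = Fintype.card K ^ 2) (h0 : f 0 = 0)
    (hε : ∀ a : K, a ≠ 0 → ε a * ε a = 1)
    (hf : ∀ (a : K) (x : F), a ≠ 0 → f (a * x) = ε a * f x) {w : F} (hw : w ≠ 0) :
    ∑ x, f x ^ 2 = ((Fintype.card K : ℤ) - 1) * (f w ^ 2 + ∑ b : K, f ((τ + b) * w) ^ 2) := by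
  have e (a : K) (x : F) (ha : a ≠ 0) : f (a * x) ^ 2 = f x ^ 2 := by
    rw [hf a x ha]; linear_combination f x ^ 2 * hε a ha
  have hc : ((Finset.univ.erase (0 : K)).card : ℤ) = (Fintype.card K : ℤ) - 1 := by
    rw [Finset.card_erase_of_mem (Finset.mem_univ _), Finset.card_univ,
      Nat.cast_sub Fintype.card_pos]; simp
  rw [sum_plane hτ hcard hw, ← Finset.add_sum_erase _ _ (Finset.mem_univ (0 : K)),
    Finset.sum_congr rfl fun a ha => e a w (Finset.ne_of_mem_erase ha),
    Finset.sum_congr rfl fun a ha => Finset.sum_congr rfl fun (b : K) _ =>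
      e a ((τ + b) * w) (Finset.ne_of_mem_erase ha)]
  simp only [Finset.sum_const, nsmul_eq_mul, hc]
  simp [h0]
  ring

/-- The autocorrelation of a function that `K` scales by signs. -/
theorem sum_mul_add_plane (hτ : τ ∉ K) (hcard : Fintype.card F = Fintype.card K ^ 2)
    (h0 : f 0 = 0) (hε : ∀ a : K, a ≠ 0 → ε a * ε a = 1)
    (hf : ∀ (a : K) (x : F), a ≠ 0 → f (a * x) = ε a * f x) {w : F} (hw : w ≠ 0) :
    ((Fintype.card K : ℤ) - 1) * ∑ x, f x * f (x + w) =
      ((Fintype.card K : ℤ) - 1) * (f w * ∑ b : K, f (b * w) + (∑ b : K, f ((τ + b) * w)) ^ 2)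
        - ∑ x, f x ^ 2 := by
  rw [sum_sq_plane hτ hcard h0 hε hf hw, sum_plane hτ hcard hw, sum_line_mul h0 hε hf]
  -- Translation by w keeps a and moves b by a⁻¹, and the sign ε a cancels. Summing over a then
  -- pairs each b with every other parameter.
  have h1 (a : K) (ha : a ∈ Finset.univ.erase (0 : K)) :
      ∑ b : K, f (a * ((τ + b) * w)) * f (a * ((τ + b) * w) + w) =
        ∑ b : K, f ((τ + b) * w) * f ((τ + (b + a⁻¹ : K)) * w) := by
    have ha := Finset.ne_of_mem_erase ha
    have ha' : (a : F) ≠ 0 := by simpa using ha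
    refine Finset.sum_congr rfl fun b _ => ?_
    have : (a : F) * ((τ + b) * w) + w = a * ((τ + (b + a⁻¹ : K)) * w) := by
      push_cast; field_simp; ring
    rw [this, hf _ _ ha, hf _ _ ha]
    linear_combination (f ((τ + b) * w) * f ((τ + (b + a⁻¹ : K)) * w)) * hε a ha
  rw [Finset.sum_congr rfl h1,
    sum_erase_inv K fun a => ∑ b : K, f ((τ + b) * w) * f ((τ + (b + a : K)) * w),
    Finset.sum_comm]
  have h2 (b : K) : ∑ a ∈ Finset.univ.erase (0 : K),
      f ((τ + b) * w) * f ((τ + (b + a : K)) * w) =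
      f ((τ + b) * w) * ∑ c : K, f ((τ + c) * w) - f ((τ + b) * w) ^ 2 := by
    have h3 : ∑ c : K, f ((τ + c) * w) = ∑ a : K, f ((τ + (b + a : K)) * w) :=
      (Fintype.sum_equiv (Equiv.addLeft b) (fun a => f ((τ + (b + a : K)) * w)) _ fun a => rfl).symm
    rw [h3, ← Finset.mul_sum, ← Finset.add_sum_erase _ _ (Finset.mem_univ (0 : K)), add_zero]
    ring
  simp only [h2, Finset.sum_sub_distrib, ← Finset.sum_mul]
  ring

/-- By invariance the sum along Kw is (|K| - 1) f w, and the vanishing total forces the sum along (τ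
+ K)w to be -f w. -/
theorem sum_mul_add_of_invariant (hτ : τ ∉ K) (hcard : Fintype.card F = Fintype.card K ^ 2)
    (h0 : f 0 = 0) (hf : ∀ (a : K) (x : F), a ≠ 0 → f (a * x) = f x) (hs : ∑ x, f x = 0)
    {w : F} (hw : w ≠ 0) :
    ((Fintype.card K : ℤ) - 1) * ∑ x, f x * f (x + w) =
      ((Fintype.card K : ℤ) - 1) * (Fintype.card K * f w ^ 2) - ∑ x, f x ^ 2 := by
  rw [sum_mul_add_plane (ε := fun _ => 1) hτ hcard h0 (by simp) (by simpa using hf) hw]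
  have hc : ((Finset.univ.erase (0 : K)).card : ℤ) = (Fintype.card K : ℤ) - 1 := by
    rw [Finset.card_erase_of_mem (Finset.mem_univ _), Finset.card_univ,
      Nat.cast_sub Fintype.card_pos]; simp
  have h1 : ∑ b : K, f (b * w) = ((Fintype.card K : ℤ) - 1) * f w := by
    rw [← Finset.add_sum_erase _ _ (Finset.mem_univ (0 : K)),
      Finset.sum_congr rfl fun a ha => hf a w (Finset.ne_of_mem_erase ha)]
    simp only [Finset.sum_const, nsmul_eq_mul, hc]
    simp [h0]
  rw [sum_plane hτ hcard hw, h1,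
    Finset.sum_congr rfl fun a ha => Finset.sum_congr rfl fun (b : K) _ =>
      hf a ((τ + b) * w) (Finset.ne_of_mem_erase ha)] at hs
  simp only [Finset.sum_const, nsmul_eq_mul, hc] at hs
  have hK : (Fintype.card K : ℤ) - 1 ≠ 0 := by
    have := Fintype.one_lt_card (α := K); omega
  have h2 : ∑ b : K, f ((τ + b) * w) = - f w := by
    apply mul_left_cancel₀ hK; linarith
  rw [h1, h2]
  ring

end Plane

/-! ### The subfield of order l -/

section QuadraticExtension

variable {F : Type*} [Field F] [Fintype F] [DecidableEq F] {α : Fˣ} {l : ℕ}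

theorem exists_prime_pow_of_card_eq_sq (hl : IsPrimePow l) (hq : Fintype.card F = l ^ 2) :
    ∃ p m : ℕ, p.Prime ∧ CharP F p ∧ 0 < m ∧ l = p ^ m := by
  obtain ⟨p, m, hp, hm, rfl⟩ := hl
  obtain ⟨p', hc, n, hp', hn⟩ := FiniteField.card' F
  have : p = p' := by
    have : p ∣ p' ^ (n : ℕ) := by
      rw [← hn, hq]; exact dvd_pow (dvd_pow_self p hm.ne') two_ne_zero
    exact (Nat.prime_dvd_prime_iff_eq hp.nat_prime hp').mp (hp.nat_prime.dvd_of_dvd_pow this)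
  subst this
  exact ⟨p, m, hp', hc, hm, rfl⟩

theorem add_pow_of_card_eq_sq (hl : IsPrimePow l) (hq : Fintype.card F = l ^ 2) (x y : F) :
    (x + y) ^ l = x ^ l + y ^ l := by
  obtain ⟨p, m, hp, hc, -, rfl⟩ := exists_prime_pow_of_card_eq_sq hl hq
  have := Fact.mk hp
  exact add_pow_char_pow x y p m

/-- The subfield of order `l` of a field of order `l ^ 2`. -/
def fixedSubfield (hl : IsPrimePow l) (hq : Fintype.card F = l ^ 2) : Subfield F where
  carrier := {x | x ^ l = x}
  mul_mem' {a b} ha hb := by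
    change (a * b) ^ l = a * b
    rw [mul_pow]
    exact congrArg₂ (· * ·) ha hb
  one_mem' := one_pow l
  add_mem' {a b} ha hb := by
    change (a + b) ^ l = a + b
    rw [add_pow_of_card_eq_sq hl hq]
    exact congrArg₂ (· + ·) ha hb
  zero_mem' := zero_pow hl.ne_zero
  neg_mem' {a} ha := by
    change (-a) ^ l = -a
    have h := add_pow_of_card_eq_sq hl hq a (-a)
    have ha : a ^ l = a := ha
    rw [add_neg_cancel, zero_pow hl.ne_zero, ha] at h
    exact eq_neg_of_add_eq_zero_right h.symm
  inv_mem' a ha := by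
    change (a⁻¹) ^ l = a⁻¹
    rw [inv_pow]
    exact congrArg _ ha

theorem mem_fixedSubfield (hl : IsPrimePow l) (hq : Fintype.card F = l ^ 2) {x : F} :
    x ∈ fixedSubfield hl hq ↔ x ^ l = x := Iff.rfl

theorem succ_dvd_card_sub_one (hq : Fintype.card F = l ^ 2) : l + 1 ∣ Fintype.card F - 1 := by
  rw [hq, ← one_pow 2, Nat.sq_sub_sq]; exact dvd_mul_right _ _

/-- For x = αⁿ, x^l = x means l² - 1 ∣ n(l - 1), that is l + 1 ∣ n. -/
theorem mem_fixedSubfield_iff (hα : Subgroup.zpowers α = ⊤) (hl : IsPrimePow l)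
    (hq : Fintype.card F = l ^ 2) {x : F} (hx : x ≠ 0) :
    x ∈ fixedSubfield hl hq ↔ ind α (l + 1) x = 0 := by
  rw [mem_fixedSubfield]
  obtain ⟨n, rfl⟩ := exists_eq_pow hα hx
  rw [ind_pow hα (succ_dvd_card_sub_one hq), ZMod.natCast_eq_zero_iff]
  have h1 := hl.one_lt
  have e : ((α : F) ^ n) ^ l = (α : F) ^ n ↔ α ^ (n * l) = α ^ n := by
    rw [← pow_mul, ← Units.val_pow_eq_pow_val, ← Units.val_pow_eq_pow_val, Units.val_inj]
  rw [e, pow_eq_pow_iff_modEq, orderOf_generator hα, hq, Nat.ModEq.comm,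
    Nat.modEq_iff_dvd' (Nat.le_mul_of_pos_right n (by omega))]
  have e2 : l ^ 2 - 1 = (l + 1) * (l - 1) := by
    rw [← Nat.sq_sub_sq, one_pow]
  have e3 : n * l - n = n * (l - 1) := by rw [Nat.mul_sub, mul_one]
  rw [e2, e3]
  exact Nat.mul_dvd_mul_iff_right (by omega)

theorem card_fixedSubfield (hα : Subgroup.zpowers α = ⊤) (hl : IsPrimePow l)
    (hq : Fintype.card F = l ^ 2) [Fintype (fixedSubfield hl hq)] :
    Fintype.card (fixedSubfield hl hq) = l := by
  classical
  have h1 := hl.one_lt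
  have h := sum_indFun hα (succ_dvd_card_sub_one hq) fun k => if k = 0 then 1 else 0
  have h2 : ∑ x : F, indFun α (l + 1) (fun k => if k = 0 then (1 : ℤ) else 0) x =
      ∑ x : F, ((if x ∈ fixedSubfield hl hq then 1 else 0) - if x = 0 then 1 else 0) := by
    refine Finset.sum_congr rfl fun x _ => ?_
    by_cases hx : x = 0
    · simp [hx]
    · simp [indFun_of_ne _ hx, mem_fixedSubfield_iff hα hl hq hx, hx]
  have h3 : Fintype.card (fixedSubfield hl hq) =
      (Finset.univ.filter (· ∈ fixedSubfield hl hq)).card := Fintype.card_subtype _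
  rw [h2, Finset.sum_sub_distrib, Finset.sum_boole, ← h3, hq] at h
  simp at h
  have h4 : ((l : ℤ) + 1) * (Fintype.card (fixedSubfield hl hq) - l) = 0 := by
    linear_combination h
  have := (mul_eq_zero.mp h4).resolve_left (by omega)
  omega

theorem generator_notMem_fixedSubfield (hα : Subgroup.zpowers α = ⊤) (hl : IsPrimePow l)
    (hq : Fintype.card F = l ^ 2) : (α : F) ∉ fixedSubfield hl hq := by
  rw [mem_fixedSubfield_iff hα hl hq (by simp), ind_generator hα (succ_dvd_card_sub_one hq)]
  have : Fact (1 < l + 1) := ⟨by have := hl.one_lt; omega⟩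
  exact one_ne_zero

theorem sq_signFun {C : Finset F} (x : F) : signFun C x ^ 2 = 1 - if x = 0 then 1 else 0 := by
  unfold signFun
  split_ifs <;> norm_num

theorem sum_sq_signFun (C : Finset F) : ∑ x, signFun C x ^ 2 = (Fintype.card F : ℤ) - 1 := by
  simp [sq_signFun]

end QuadraticExtension

/-! ### Case (3): unions of punctured lines -/

section UnionOfLines

variable {F : Type*} [Field F] [Fintype F] [DecidableEq F] {α : Fˣ} {l : ℕ}

theorem odd_of_card_eq_sq (hodd : Odd (Fintype.card F)) (hq : Fintype.card F = l ^ 2) : Odd l := by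
  rw [hq] at hodd
  exact Nat.Odd.of_mul_left (by rwa [sq] at hodd)

theorem eight_dvd_card_sub_one (hodd : Odd (Fintype.card F)) (hq : Fintype.card F = l ^ 2) :
    8 ∣ Fintype.card F - 1 := by
  obtain ⟨k, hk⟩ := odd_of_card_eq_sq hodd hq
  rw [hq]
  exact Nat.eight_dvd_sq_sub_one_of_odd ⟨k, hk⟩

theorem mem_biUnion_cyclotomicClass (hα : Subgroup.zpowers α = ⊤) {e : ℕ}
    (he : e ∣ Fintype.card F - 1) {I : Finset ℕ} {x : F} :
    (x ∈ I.biUnion fun i => cyclotomicClass α e i) ↔ x ≠ 0 ∧ ∃ i ∈ I, ind α e x = i := by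
  simp only [Finset.mem_biUnion, mem_cyclotomicClass hα he]
  tauto

theorem signFun_biUnion (hα : Subgroup.zpowers α = ⊤) {e : ℕ} (he : e ∣ Fintype.card F - 1)
    (I : Finset ℕ) (x : F) :
    signFun (I.biUnion fun i => cyclotomicClass α e i) x =
      indFun α e (fun k => if k ∈ I.image (Nat.cast : ℕ → ZMod e) then (1 : ℤ) else -1) x := by
  by_cases hx : x = 0
  · simp [signFun, hx]
  · simp [signFun, hx, indFun_of_ne, mem_cyclotomicClass hα he, eq_comm]

theorem sum_signFun_biUnion (hα : Subgroup.zpowers α = ⊤) {e : ℕ} (he : e ∣ Fintype.card F - 1)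
    {I : Finset ℕ} (hI : I ⊆ Finset.range e) (hc : 2 * I.card = e) :
    ∑ x, signFun (I.biUnion fun i => cyclotomicClass α e i) x = 0 := by
  have := neZero_of_dvd he
  have h := sum_indFun hα he
    (fun k => if k ∈ I.image (Nat.cast : ℕ → ZMod e) then (1 : ℤ) else -1)
  have h1 : (I.image (Nat.cast : ℕ → ZMod e)).card = I.card := by
    refine Finset.card_image_of_injOn fun a ha b hb hab => ?_
    have ha := Finset.mem_range.mp (hI ha)
    have hb := Finset.mem_range.mp (hI hb)
    have := (ZMod.natCast_eq_natCast_iff _ _ _).mp hab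
    exact Nat.ModEq.eq_of_lt_of_lt this ha hb
  have h2 : ∑ k, (if k ∈ I.image (Nat.cast : ℕ → ZMod e) then (1 : ℤ) else -1) = 0 := by
    have (k : ZMod e) : (if k ∈ I.image (Nat.cast : ℕ → ZMod e) then (1 : ℤ) else -1) =
        2 * (if k ∈ I.image (Nat.cast : ℕ → ZMod e) then 1 else 0) - 1 := by
      split_ifs <;> norm_num
    simp only [this, Finset.sum_sub_distrib, ← Finset.mul_sum, Finset.sum_ite_mem,
      Finset.univ_inter, Finset.sum_const, h1, Finset.card_univ, ZMod.card]
    simp only [nsmul_eq_mul, mul_one]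
    omega
  rw [h2, mul_zero] at h
  simp only [signFun_biUnion hα he]
  exact (mul_eq_zero.mp h).resolve_left (by simpa using this.out)

/-- The autocorrelation is l - (l + 1) = -1, and C = -C because -1 lies in the subfield; so the
count is (q-1)/4 off C and one less on C. -/
theorem diffCount_biUnion (hα : Subgroup.zpowers α = ⊤)
    (hl : IsPrimePow l) (hq : Fintype.card F = l ^ 2) {I : Finset ℕ}
    (hI : I ⊆ Finset.range (l + 1)) (hc : 2 * I.card = l + 1) {w : F} (hw : w ≠ 0) :
    4 * diffCount (I.biUnion fun i => cyclotomicClass α (l + 1) i) w + 5 = Fintype.card F ∨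
      4 * diffCount (I.biUnion fun i => cyclotomicClass α (l + 1) i) w + 1 = Fintype.card F := by
  classical
  have he := succ_dvd_card_sub_one hq
  set C := I.biUnion fun i => cyclotomicClass α (l + 1) i with hC
  have h0 : (0 : F) ∉ C := by
    rw [hC, mem_biUnion_cyclotomicClass hα he]; simp
  have hs : ∑ x, signFun C x = 0 := sum_signFun_biUnion hα he hI hc
  have hinv (a : fixedSubfield hl hq) (x : F) (ha : a ≠ 0) : a * x ∈ C ↔ x ∈ C := by
    have ha' : (a : F) ≠ 0 := by simpa using ha
    rw [hC, mem_biUnion_cyclotomicClass hα he, mem_biUnion_cyclotomicClass hα he]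
    by_cases hx : x = 0
    · simp [hx]
    · rw [ind_mul hα he ha' hx, (mem_fixedSubfield_iff hα hl hq ha').mp a.2, zero_add]
      simp [ha', hx]
  have hK := card_fixedSubfield hα hl hq
  have h1 := sum_mul_add_of_invariant (generator_notMem_fixedSubfield hα hl hq)
    (by rw [hK, hq]) (f := signFun C) (by simp [signFun])
    (fun a x ha => by
      have ha' : (a : F) ≠ 0 := by simpa using ha
      simp [signFun, hinv a x ha, ha']) hs hw
  have hl1 := hl.one_lt
  have hA : ∑ x, signFun C x * signFun C (x + w) = -1 := by
    rw [hK, sum_sq_signFun, sq_signFun, hq] at h1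
    have hne : (l : ℤ) - 1 ≠ 0 := by omega
    apply mul_left_cancel₀ hne
    rw [h1]
    simp [hw]
    ring
  rw [sum_signFun_mul h0 hs hw] at hA
  have hneg : -w ∈ C ↔ w ∈ C := by
    have := hinv (-1) w (by simp)
    simpa using this
  by_cases h : w ∈ C
  · simp only [hneg, h, if_true] at hA; omega
  · simp only [hneg, h, if_false] at hA; omega

theorem sum_biUnion_eq_zero (hα : Subgroup.zpowers α = ⊤) {e : ℕ} (he : e ∣ Fintype.card F - 1)
    (h0 : 0 < e) (hlt : e < Fintype.card F - 1) (I : Finset ℕ) :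
    ∑ x ∈ I.biUnion fun i => cyclotomicClass α e i, x = 0 := by
  refine sum_eq_zero_of_mul_mem (by simp) (generator_pow_ne_one hα h0 hlt) fun x => ?_
  simp only [Finset.mem_biUnion, generator_pow_mul_mem hα he]

theorem biUnion_ne_cyclotomicClass_two (hα : Subgroup.zpowers α = ⊤) {e : ℕ}
    (he : e ∣ Fintype.card F - 1) (h2 : 2 ∣ Fintype.card F - 1) {I : Finset ℕ} {i j k : ℕ}
    (hi : i ∈ I) (hie : Even i) (hj : j ∈ I) (hjo : Odd j) :
    (I.biUnion fun i => cyclotomicClass α e i) ≠ cyclotomicClass α 2 k := by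
  intro h
  have a (n : ℕ) (hn : n ∈ I) : (n : ZMod 2) = k := by
    have : (α : F) ^ n ∈ cyclotomicClass α 2 k := by
      rw [← h, mem_biUnion_cyclotomicClass hα he]
      exact ⟨by simp, n, hn, ind_pow hα he n⟩
    rw [mem_cyclotomicClass hα h2, ind_pow hα h2] at this
    exact this.2
  have := (a i hi).trans (a j hj).symm
  rw [(ZMod.natCast_eq_zero_iff_even).mpr hie, (ZMod.natCast_eq_one_iff_odd).mpr hjo] at this
  exact absurd this (by decide)

end UnionOfLines

/-! ### Lucas' theorem and uniqueness of representations by x² + y² and x² + 2y² -/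

section Arithmetic

theorem not_dvd_choose_mul_add {p a b N M : ℕ} (hp : p.Prime) (ha : a < p) (hb : b ≤ a)
    (h : ¬ p ∣ N.choose M) : ¬ p ∣ (p * N + a).choose (p * M + b) := by
  have := Fact.mk hp
  have h1 := Choose.choose_modEq_choose_mod_mul_choose_div_nat (p := p) (n := p * N + a)
    (k := p * M + b)
  have hb' : b < p := hb.trans_lt ha
  rw [Nat.mul_add_mod, Nat.mul_add_mod, Nat.mod_eq_of_lt ha, Nat.mod_eq_of_lt hb',
    Nat.mul_add_div hp.pos, Nat.mul_add_div hp.pos, Nat.div_eq_of_lt ha, Nat.div_eq_of_lt hb',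
    add_zero, add_zero] at h1
  rw [h1.dvd_iff dvd_rfl, hp.dvd_mul]
  rintro (h2 | h2)
  · have h3 : a.choose b ∣ a.factorial :=
      ⟨b.factorial * (a - b).factorial, by rw [← Nat.choose_mul_factorial_mul_factorial hb]; ring⟩
    have := (hp.dvd_factorial).mp (h2.trans h3)
    omega
  · exact h h2

/-- If p = 4c + 1, the base-p digits of m are all c and those of 3m are all 3c. -/
theorem exists_not_dvd_choose_three_mul {p : ℕ} (hp : p.Prime) (h1 : p % 4 = 1) (n : ℕ) :
    ∃ m, p ^ n = 4 * m + 1 ∧ ¬ p ∣ (3 * m).choose m := by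
  induction n with
  | zero => exact ⟨0, by simp, by simpa using hp.one_lt.ne'⟩
  | succ n ih =>
    obtain ⟨m, hm, hd⟩ := ih
    obtain ⟨c, hc⟩ : ∃ c, p = 4 * c + 1 := ⟨p / 4, by omega⟩
    refine ⟨p * m + c, ?_, ?_⟩
    · rw [pow_succ, hm]; nlinarith
    · rw [show 3 * (p * m + c) = p * (3 * m) + 3 * c by ring]
      exact not_dvd_choose_mul_add hp (by omega) (by omega) hd

/-- If p = 8c + 3, the base-p digits of m alternate between c and 3c + 1, while those of 4m + 1 are
all 4c + 1; hence two digits per induction step. -/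
theorem exists_not_dvd_choose_of_mod_eight {p : ℕ} (hp : p.Prime) (h3 : p % 8 = 3) (n : ℕ) :
    ∃ m, p ^ (2 * n + 1) = 8 * m + 3 ∧ ¬ p ∣ (4 * m + 1).choose m := by
  obtain ⟨c, hc⟩ : ∃ c, p = 8 * c + 3 := ⟨p / 8, by omega⟩
  induction n with
  | zero =>
    refine ⟨c, by simpa using hc, ?_⟩
    have := not_dvd_choose_mul_add (a := 4 * c + 1) (b := c) (N := 0) (M := 0) hp (by omega)
      (by omega) (by simpa using hp.one_lt.ne')
    simpa using this
  | succ n ih =>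
    obtain ⟨m, hm, hd⟩ := ih
    refine ⟨p * (p * m + (3 * c + 1)) + c, ?_, ?_⟩
    · rw [show 2 * (n + 1) + 1 = (2 * n + 1) + 1 + 1 by ring, pow_succ, pow_succ, hm]
      subst hc; ring
    · have h := not_dvd_choose_mul_add (a := 4 * c + 1) (b := c) hp (by omega) (by omega)
        (not_dvd_choose_mul_add (a := 4 * c + 1) (b := 3 * c + 1) hp (by omega) (by omega) hd)
      have e : 4 * (p * (p * m + (3 * c + 1)) + c) + 1 =
          p * (p * (4 * m + 1) + (4 * c + 1)) + (4 * c + 1) := by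
        subst hc; ring
      rw [e]; exact h

theorem prime_pow_dvd_or_dvd {p : ℕ} (hp : p.Prime) {n : ℕ} {x y : ℤ}
    (h : ((p : ℤ) ^ n) ∣ x * y) (hxy : ¬ ((p : ℤ) ∣ x ∧ (p : ℤ) ∣ y)) :
    (p : ℤ) ^ n ∣ x ∨ (p : ℤ) ^ n ∣ y := by
  have hp' := Nat.prime_iff_prime_int.mp hp
  by_cases hx : (p : ℤ) ∣ x
  · exact Or.inl (hp'.pow_dvd_of_dvd_mul_right n (fun hy => hxy ⟨hx, hy⟩) h)
  · exact Or.inr (hp'.pow_dvd_of_dvd_mul_left n hx h)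

theorem eq_zero_or_eq_zero_of_sq_mul_add_sq {q k r : ℤ} (hq : 0 < q) (h : (q * k) ^ 2 + r ^ 2 = q ^ 2) :
    k = 0 ∨ r = 0 := by
  by_contra! hn
  have h1 : 1 ≤ k ^ 2 := by have := pow_pos (abs_pos.mpr hn.1) 2; rw [sq_abs] at this; omega
  have h2 : 0 < r ^ 2 := by have := pow_pos (abs_pos.mpr hn.2) 2; rwa [sq_abs] at this
  nlinarith [pow_pos hq 2]

/-- Primitive representations of a prime power as a sum of two squares are unique. -/
theorem sq_eq_four_of_sum_two_squares {p n : ℕ} (hp : p.Prime) (hp2 : p ≠ 2) {a b s : ℤ}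
    (hn : n ≠ 0) (hab : a ^ 2 + b ^ 2 = (p : ℤ) ^ n) (hs : s ^ 2 + 4 = (p : ℤ) ^ n)
    (hnd : ¬ ((p : ℤ) ∣ a ∧ (p : ℤ) ∣ b)) : b ^ 2 = 4 ∨ a ^ 2 = 4 := by
  have hp' := Nat.prime_iff_prime_int.mp hp
  have hpq : (p : ℤ) ∣ (p : ℤ) ^ n := dvd_pow_self _ hn
  have hq : 0 < (p : ℤ) ^ n := pow_pos (by exact_mod_cast hp.pos) n
  set q := (p : ℤ) ^ n with hqdef
  have hp4 : ¬ (p : ℤ) ∣ 4 := by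
    intro h
    have h1 : p ∣ 2 ^ 2 := by exact_mod_cast h
    exact hp2 ((Nat.prime_dvd_prime_iff_eq hp Nat.prime_two).mp (hp.dvd_of_dvd_pow h1))
  have hfin (c : ℤ) (hc : c ^ 2 = b ^ 2) (hd : q ∣ 2 * a - c * s) : b ^ 2 = 4 ∨ a ^ 2 = 4 := by
    obtain ⟨k, hk⟩ := hd
    -- Brahmagupta's identity for (a² + c²)(s² + 4).
    have h1 : (q * k) ^ 2 + (a * s + 2 * c) ^ 2 = q ^ 2 := by
      rw [← hk]
      linear_combination (4 + s ^ 2) * hab + q * hs + (4 + s ^ 2) * hc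
    rcases eq_zero_or_eq_zero_of_sq_mul_add_sq hq h1 with h | h
    · left
      rw [h, mul_zero] at hk
      apply mul_left_cancel₀ hq.ne'
      linear_combination -(2 * a + c * s) * hk - s ^ 2 * hc + 4 * hab - b ^ 2 * hs
    · right
      apply mul_left_cancel₀ hq.ne'
      linear_combination (a * s - 2 * c) * h - a ^ 2 * hs + 4 * hc + 4 * hab
  have hmul : q ∣ (2 * a - b * s) * (2 * a + b * s) :=
    ⟨4 - b ^ 2, by linear_combination 4 * hab - b ^ 2 * hs⟩
  have hprim : ¬ ((p : ℤ) ∣ 2 * a - b * s ∧ (p : ℤ) ∣ 2 * a + b * s) := by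
    rintro ⟨h1, h2⟩
    have h3 : (p : ℤ) ∣ 4 * a := by
      have := dvd_add h1 h2
      rwa [show 2 * a - b * s + (2 * a + b * s) = 4 * a by ring] at this
    have ha := (hp'.dvd_or_dvd h3).resolve_left hp4
    refine hnd ⟨ha, hp'.dvd_of_dvd_pow (n := 2) ?_⟩
    rw [show b ^ 2 = q - a ^ 2 by linarith]
    exact dvd_sub hpq (dvd_pow ha two_ne_zero)
  rcases prime_pow_dvd_or_dvd hp hmul hprim with h | h
  · exact hfin b rfl h
  · exact hfin (-b) (by ring) (by rwa [neg_mul, sub_neg_eq_add])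

theorem sq_eq_one_of_sq_add_two_mul_sq {p n : ℕ} (hp : p.Prime) (hp2 : p ≠ 2) {a b t : ℤ}
    (hn : n ≠ 0) (hab : a ^ 2 + 2 * b ^ 2 = (p : ℤ) ^ n) (ht : t ^ 2 + 2 = (p : ℤ) ^ n)
    (hnd : ¬ ((p : ℤ) ∣ a ∧ (p : ℤ) ∣ b)) : b ^ 2 = 1 := by
  have hp' := Nat.prime_iff_prime_int.mp hp
  have hpq : (p : ℤ) ∣ (p : ℤ) ^ n := dvd_pow_self _ hn
  have hq : 0 < (p : ℤ) ^ n := pow_pos (by exact_mod_cast hp.pos) n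
  set q := (p : ℤ) ^ n with hqdef
  have hp2' : ¬ (p : ℤ) ∣ 2 := by
    intro h
    have h1 : p ∣ 2 := by exact_mod_cast h
    exact hp2 ((Nat.prime_dvd_prime_iff_eq hp Nat.prime_two).mp h1)
  have hfin (c : ℤ) (hc : c ^ 2 = b ^ 2) (hd : q ∣ a - c * t) : b ^ 2 = 1 := by
    obtain ⟨k, hk⟩ := hd
    -- The analogous identity for x² + 2y²; here the coefficient 2 forces k = 0.
    have h1 : 2 * (q * k) ^ 2 + (a * t + 2 * c) ^ 2 = q ^ 2 := by
      rw [← hk]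
      linear_combination (2 + t ^ 2) * hab + q * ht + 2 * (2 + t ^ 2) * hc
    have hk0 : k = 0 := by
      by_contra hne
      have h2 : 1 ≤ k ^ 2 := by have := pow_pos (abs_pos.mpr hne) 2; rw [sq_abs] at this; omega
      nlinarith [pow_pos hq 2, sq_nonneg (a * t + 2 * c)]
    rw [hk0, mul_zero] at hk
    apply mul_left_cancel₀ hq.ne'
    linear_combination -(a + c * t) * hk - t ^ 2 * hc + hab - b ^ 2 * ht
  have hmul : q ∣ (a - b * t) * (a + b * t) :=
    ⟨1 - b ^ 2, by linear_combination hab - b ^ 2 * ht⟩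
  have hprim : ¬ ((p : ℤ) ∣ a - b * t ∧ (p : ℤ) ∣ a + b * t) := by
    rintro ⟨h1, h2⟩
    have h3 : (p : ℤ) ∣ 2 * a := by
      have := dvd_add h1 h2
      rwa [show a - b * t + (a + b * t) = 2 * a by ring] at this
    have ha := (hp'.dvd_or_dvd h3).resolve_left hp2'
    have h4 : (p : ℤ) ∣ 2 * b ^ 2 := by
      rw [show 2 * b ^ 2 = q - a ^ 2 by linarith]
      exact dvd_sub hpq (dvd_pow ha two_ne_zero)
    exact hnd ⟨ha, hp'.dvd_of_dvd_pow ((hp'.dvd_or_dvd h4).resolve_left hp2')⟩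
  rcases prime_pow_dvd_or_dvd hp hmul hprim with h | h
  · exact hfin b rfl h
  · exact hfin (-b) (by ring) (by rwa [neg_mul, sub_neg_eq_add])

end Arithmetic

/-! ### Power sums over F -/

section PowerSums

variable {F : Type*} [Field F] [Fintype F]

theorem sum_pow_eq_ite {k : ℕ} (hk : k ≠ 0) :
    ∑ x : F, x ^ k = if Fintype.card F - 1 ∣ k then -1 else 0 := by
  classical
  rw [← FiniteField.sum_pow_units F k, ← Finset.add_sum_erase _ _ (Finset.mem_univ (0 : F)),
    zero_pow hk, zero_add]
  symm
  refine Finset.sum_bij (fun u _ => (u : F)) (by simp) (fun a _ b _ h => Units.ext h) ?_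
    (fun _ _ => by simp)
  intro x hx
  exact ⟨Units.mk0 x (Finset.ne_of_mem_erase hx), by simp, rfl⟩

/-- Only the monomials of positive degree divisible by `q - 1` contribute to a power sum. -/
theorem sum_sum_pow_eq {s : Finset ℕ} (c : ℕ → F) (E : ℕ → ℕ) {j₀ : ℕ} (hj : j₀ ∈ s)
    (hE : ∀ j ∈ s, E j ≠ 0) (h₀ : Fintype.card F - 1 ∣ E j₀)
    (h : ∀ j ∈ s, Fintype.card F - 1 ∣ E j → j = j₀) :
    ∑ x : F, ∑ j ∈ s, c j * x ^ E j = -c j₀ := by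
  rw [Finset.sum_comm, Finset.sum_eq_single j₀]
  · rw [← Finset.mul_sum, sum_pow_eq_ite (hE _ hj), if_pos h₀]; ring
  · intro j hjs hne
    rw [← Finset.mul_sum, sum_pow_eq_ite (hE _ hjs), if_neg fun hd => hne (h j hjs hd), mul_zero]
  · exact fun hn => absurd hj hn

end PowerSums

/-! ### The index of -1 -/

section NegOne

variable {F : Type*} [Field F] [Fintype F] {α : Fˣ}

theorem generator_pow_half (hα : Subgroup.zpowers α = ⊤) (hodd : Odd (Fintype.card F)) :
    (α : F) ^ ((Fintype.card F - 1) / 2) = -1 := by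
  have h1 := Fintype.one_lt_card (α := F)
  obtain ⟨k, hk⟩ := hodd
  have hk2 : (Fintype.card F - 1) / 2 = k := by omega
  have h2 : ((α : F) ^ k) ^ 2 = 1 := by
    rw [← pow_mul, show k * 2 = Fintype.card F - 1 by omega]
    exact FiniteField.pow_card_sub_one_eq_one _ (by simp)
  rw [hk2]
  refine (sq_eq_one_iff.mp h2).resolve_left fun h => ?_
  have h3 : α ^ k = 1 := by ext; simpa using h
  have := Nat.le_of_dvd (by omega) (orderOf_dvd_of_pow_eq_one h3)
  rw [orderOf_generator hα] at this
  omega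

theorem ind_neg_one (hα : Subgroup.zpowers α = ⊤) (hodd : Odd (Fintype.card F)) {e : ℕ}
    (he : e ∣ Fintype.card F - 1) :
    ind α e (-1 : F) = ((Fintype.card F - 1) / 2 : ℕ) := by
  rw [← generator_pow_half hα hodd, ind_pow hα he]

end NegOne

/-! ### Case (1): the quartic Jacobi sum -/

section Quartic

variable {F : Type*} [Field F] [Fintype F] {α : Fˣ}

theorem gaussianInt_I_pow_four : (⟨0, 1⟩ : GaussianInt) ^ 4 = 1 := by
  decide

/-- The quartic character with Gaussian integer values that sends the generator `α` to `i`. -/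
noncomputable def quarticChar (hα : Subgroup.zpowers α = ⊤) (h4 : 4 ∣ Fintype.card F - 1) :
    MulChar F GaussianInt :=
  indChar hα h4 gaussianInt_I_pow_four

variable (hα : Subgroup.zpowers α = ⊤) (h4 : 4 ∣ Fintype.card F - 1)

/-- Over ℂ, J(χ⁻¹,χ⁻¹) is the conjugate of J(χ,χ), and their product is q because χ and χ² are
nontrivial. -/
theorem norm_jacobiSum_quarticChar :
    (jacobiSum (quarticChar hα h4) (quarticChar hα h4)).re ^ 2 +
      (jacobiSum (quarticChar hα h4) (quarticChar hα h4)).im ^ 2 = Fintype.card F := by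
  set χ := (quarticChar hα h4).ringHomComp GaussianInt.toComplex with hχ
  have hval : χ (α : F) = Complex.I := by
    rw [hχ, MulChar.ringHomComp_apply, quarticChar]
    have := indChar_pow hα h4 gaussianInt_I_pow_four 1
    rw [pow_one, pow_one] at this
    rw [this]
    simp [GaussianInt.toComplex_def']
  have h1 : χ ≠ 1 := by
    intro h
    rw [h, MulChar.one_apply_coe] at hval
    have := congrArg Complex.re hval
    simp at this
  have h2 : χ * χ ≠ 1 := by
    intro h
    have h3 := congrArg (fun ψ : MulChar F ℂ => ψ (α : F)) h
    simp only [MulChar.mul_apply, hval, MulChar.one_apply_coe, Complex.I_mul_I] at h3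
    norm_num at h3
  have hchar : ringChar ℂ ≠ ringChar F := by
    rw [ringChar.eq_zero]
    exact (CharP.ringChar_ne_zero_of_finite F).symm
  have h3 := jacobiSum_mul_jacobiSum_inv hchar h1 h1 h2
  have h4' : jacobiSum χ⁻¹ χ⁻¹ = star (jacobiSum χ χ) := by
    simp only [jacobiSum, star_sum, star_mul', MulChar.star_apply']
  rw [h4', hχ, jacobiSum_ringHomComp] at h3
  set J := jacobiSum (quarticChar hα h4) (quarticChar hα h4)
  rw [← starRingEnd_apply, Complex.mul_conj, ← GaussianInt.intCast_real_norm] at h3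
  have h5 : J.norm = Fintype.card F := by exact_mod_cast h3
  rw [← h5, Zsqrtd.norm_def]
  ring

/-- The reduction of the quartic Jacobi sum modulo a prime above the characteristic. -/
theorem exists_ringHom_jacobiSum_quarticChar {m : ℕ} (hm : Fintype.card F = 4 * m + 1) :
    ∃ θ : GaussianInt →+* F, θ (jacobiSum (quarticChar hα h4) (quarticChar hα h4)) =
      -((-1) ^ m * ((3 * m).choose m : F)) := by
  have hodd : Odd (Fintype.card F) := ⟨2 * m, by omega⟩
  have hm0 : 0 < m := by have := Fintype.one_lt_card (α := F); omega
  have hhalf := generator_pow_half hα hodd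
  rw [show (Fintype.card F - 1) / 2 = 2 * m by omega] at hhalf
  -- With 3m the polynomial x^(3m) (1 - x)^(3m) has a term of degree q - 1 = 4m; with exponent m its
  -- degree would stay below q - 1.
  set z : F := (α : F) ^ (3 * m) with hz
  have hz2 : z * z = ((-1 : ℤ) : F) := by
    rw [hz, ← pow_add, show 3 * m + 3 * m = (2 * m) * 3 by ring, pow_mul, hhalf]
    norm_num
  let θ : GaussianInt →+* F := Zsqrtd.lift ⟨z, hz2⟩
  have hθI : θ ⟨0, 1⟩ = z := by simp [θ, Zsqrtd.lift]
  have hθ (x : F) : θ (quarticChar hα h4 x) = x ^ (3 * m) := by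
    by_cases hx : x = 0
    · rw [hx, MulChar.map_zero, map_zero, zero_pow (by omega)]
    · obtain ⟨n, rfl⟩ := exists_eq_pow hα hx
      rw [quarticChar, indChar_pow, map_pow, hθI, hz, ← pow_mul, ← pow_mul, mul_comm]
  refine ⟨θ, ?_⟩
  have h1 : θ (jacobiSum (quarticChar hα h4) (quarticChar hα h4)) =
      ∑ x : F, ∑ j ∈ Finset.range (3 * m + 1),
        ((-1) ^ j * ((3 * m).choose j : F)) * x ^ (3 * m + j) := by
    rw [jacobiSum, map_sum]
    refine Finset.sum_congr rfl fun x _ => ?_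
    rw [map_mul, hθ, hθ, sub_eq_neg_add, add_pow, Finset.mul_sum]
    refine Finset.sum_congr rfl fun j _ => ?_
    rw [neg_pow, one_pow, pow_add]
    ring
  rw [h1]
  refine sum_sum_pow_eq (fun j => (-1) ^ j * ((3 * m).choose j : F)) (fun j => 3 * m + j)
    (by simp; omega) (fun j _ => by omega) ⟨1, by omega⟩ ?_
  intro j hj hd
  rw [Finset.mem_range] at hj
  rw [show Fintype.card F - 1 = 4 * m by omega] at hd
  obtain ⟨c, hc⟩ := hd
  have hc1 : c < 2 := by
    by_contra! h
    have := Nat.mul_le_mul_left (4 * m) h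
    omega
  have hc0 : c ≠ 0 := by rintro rfl; omega
  obtain rfl : c = 1 := by omega
  omega

theorem not_dvd_jacobiSum_quarticChar {p : ℕ} [CharP F p] {m : ℕ}
    (hm : Fintype.card F = 4 * m + 1) (hd : ¬ p ∣ (3 * m).choose m) :
    ¬ ((p : ℤ) ∣ (jacobiSum (quarticChar hα h4) (quarticChar hα h4)).re ∧
      (p : ℤ) ∣ (jacobiSum (quarticChar hα h4) (quarticChar hα h4)).im) := by
  obtain ⟨θ, hθ⟩ := exists_ringHom_jacobiSum_quarticChar hα h4 hm
  set J := jacobiSum (quarticChar hα h4) (quarticChar hα h4)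
  rintro ⟨⟨a, ha⟩, b, hb⟩
  have hJ : J = (p : GaussianInt) * ⟨a, b⟩ := by
    ext <;> simp [ha, hb]
  rw [hJ, map_mul, map_natCast, CharP.cast_eq_zero, zero_mul, eq_comm, neg_eq_zero,
    mul_eq_zero] at hθ
  rcases hθ with h | h
  · exact absurd h (pow_ne_zero _ (by simp))
  · exact hd ((CharP.cast_eq_zero_iff F p _).mp h)

variable [DecidableEq F]

/-- Re + Im of the j-th power of the imaginary unit is 1 for j = 0, 1 and -1 for j = 2, 3; the
prefactor rotates class `i` to class 0. -/
theorem signFun_union_quartic (i : ℕ) (x : F) :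
    signFun (cyclotomicClass α 4 i ∪ cyclotomicClass α 4 (i + 1)) x =
      (⟨0, -1⟩ ^ i * quarticChar hα h4 x).re + (⟨0, -1⟩ ^ i * quarticChar hα h4 x).im := by
  by_cases hx : x = 0
  · rw [hx, MulChar.map_zero]; simp [signFun]
  · simp only [signFun, hx, if_false, Finset.mem_union, mem_cyclotomicClass hα h4, quarticChar,
      indChar_apply, indFun_of_ne _ hx, ne_eq, not_false_eq_true, true_and, Nat.cast_add,
      Nat.cast_one]
    have h1 : (⟨0, -1⟩ : GaussianInt) ^ i = ⟨0, -1⟩ ^ (i : ZMod 4).val := by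
      rw [ZMod.val_natCast]; exact pow_eq_pow_mod i (by decide)
    rw [h1]
    generalize (i : ZMod 4) = k
    generalize ind α 4 x = j
    revert k j
    decide

theorem star_quarticChar (x : F) : star (quarticChar hα h4 x) = (quarticChar hα h4)⁻¹ x := by
  by_cases hx : x = 0
  · rw [hx, MulChar.map_zero, MulChar.map_zero, star_zero]
  · have h1 : quarticChar hα h4 x * (quarticChar hα h4)⁻¹ x = 1 := by
      rw [← MulChar.mul_apply, mul_inv_cancel, MulChar.one_apply (Ne.isUnit hx)]
    have h2 : quarticChar hα h4 x * star (quarticChar hα h4 x) = 1 := by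
      rw [quarticChar, indChar_apply, indFun_of_ne _ hx, star_pow, ← mul_pow]
      have : (⟨0, 1⟩ : GaussianInt) * star ⟨0, 1⟩ = 1 := by decide
      rw [this, one_pow]
    have h3 : quarticChar hα h4 x ≠ 0 := by
      intro h; rw [h, zero_mul] at h1; exact zero_ne_one h1
    exact mul_left_cancel₀ h3 (h2.trans h1.symm)

theorem quarticChar_ne_one : quarticChar hα h4 ≠ 1 := by
  intro h
  have h3 := indChar_pow hα h4 gaussianInt_I_pow_four 1
  rw [← quarticChar, h, pow_one, MulChar.one_apply_coe, pow_one] at h3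
  exact absurd h3 (by decide)

include hα h4 in
theorem sum_signFun_union_quartic (i : ℕ) :
    ∑ x : F, signFun (cyclotomicClass α 4 i ∪ cyclotomicClass α 4 (i + 1)) x = 0 := by
  have h := MulChar.sum_eq_zero_of_ne_one (quarticChar_ne_one hα h4)
  let g : GaussianInt →+ ℤ :=
    { toFun := fun u => (⟨0, -1⟩ ^ i * u).re + (⟨0, -1⟩ ^ i * u).im
      map_zero' := by simp
      map_add' := fun u v => by simp only [mul_add, Zsqrtd.re_add, Zsqrtd.im_add]; ring }
  have h2 := congrArg g h
  rw [map_sum, map_zero] at h2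
  rw [← h2]
  exact Finset.sum_congr rfl fun x _ => signFun_union_quartic hα h4 i x

theorem sum_signFun_mul_union_quartic (i : ℕ) {w : F}
    (hw : w ≠ 0) :
    ∃ δ : ℤ, (δ = 1 ∨ δ = -1) ∧
    ∑ x, signFun (cyclotomicClass α 4 i ∪ cyclotomicClass α 4 (i + 1)) x *
        signFun (cyclotomicClass α 4 i ∪ cyclotomicClass α 4 (i + 1)) (x + w) =
      -1 + δ * (jacobiSum (quarticChar hα h4) (quarticChar hα h4)).im := by
  set ψ := quarticChar hα h4 with hψ
  set u : GaussianInt := ⟨0, -1⟩ ^ i with hu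
  have huu : u * star u = 1 := by
    rw [hu, star_pow, ← mul_pow, show (⟨0, -1⟩ : GaussianInt) * star ⟨0, -1⟩ = 1 by decide,
      one_pow]
  -- For c = ua and d = ub this is (Re c + Im c)(Re d + Im d) = Re(c d̄) + Im(cd). The first part
  -- sums to -1, the second to a Jacobi sum.
  have hprod (a b : GaussianInt) :
      ((u * a).re + (u * a).im) * ((u * b).re + (u * b).im) =
        (a * star b).re + (u * u * (a * b)).im := by
    have h1 : (a * star b) = (u * a) * star (u * b) := by
      rw [star_mul']
      linear_combination -(a * star b) * huu
    have h2 : u * u * (a * b) = (u * a) * (u * b) := by ring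
    rw [h1, h2]
    generalize u * a = c
    generalize u * b = d
    simp
    ring
  have hsum : ∑ x, signFun (cyclotomicClass α 4 i ∪ cyclotomicClass α 4 (i + 1)) x *
        signFun (cyclotomicClass α 4 i ∪ cyclotomicClass α 4 (i + 1)) (x + w) =
      (∑ x, ψ x * ψ⁻¹ (x + w)).re + (u * u * ∑ x, ψ x * ψ (x + w)).im := by
    have hre (s : F → GaussianInt) : (∑ x, s x).re = ∑ x, (s x).re :=
      map_sum (⟨⟨Zsqrtd.re, rfl⟩, fun _ _ => rfl⟩ : GaussianInt →+ ℤ) s _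
    have him (s : F → GaussianInt) : (∑ x, s x).im = ∑ x, (s x).im :=
      map_sum (⟨⟨Zsqrtd.im, rfl⟩, fun _ _ => rfl⟩ : GaussianInt →+ ℤ) s _
    rw [Finset.mul_sum, hre, him, ← Finset.sum_add_distrib]
    refine Finset.sum_congr rfl fun x _ => ?_
    rw [signFun_union_quartic hα h4, signFun_union_quartic hα h4, hprod, star_quarticChar]
  rw [hsum, sum_mulChar_mul_inv_add (quarticChar_ne_one hα h4) hw,
    sum_mulChar_mul_mulChar_add _ _ hw]
  have hsq : ∀ j : ZMod 4, ((⟨0, 1⟩ : GaussianInt) ^ j.val * ⟨0, 1⟩ ^ j.val = 1 ∨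
      (⟨0, 1⟩ : GaussianInt) ^ j.val * ⟨0, 1⟩ ^ j.val = -1) := by decide
  have e1 : ψ w * ψ w = 1 ∨ ψ w * ψ w = -1 := by
    rw [hψ, quarticChar, indChar_apply, indFun_of_ne _ hw]
    exact hsq _
  have e2 : u * u = 1 ∨ u * u = -1 := by
    rw [hu, ← mul_pow, show (⟨0, -1⟩ : GaussianInt) * ⟨0, -1⟩ = -1 by decide]
    exact neg_one_pow_eq_or _ i
  have e3 : ψ (-1) = 1 ∨ ψ (-1) = -1 := by
    have : ψ (-1) * ψ (-1) = 1 := by rw [← map_mul]; simp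
    exact mul_self_eq_one_iff.mp this
  have e4 : ∃ δ : ℤ, (δ = 1 ∨ δ = -1) ∧ u * u * (ψ (-1) * (ψ w * ψ w)) = (δ : GaussianInt) := by
    rcases e1 with h | h <;> rcases e2 with h' | h' <;> rcases e3 with h'' | h'' <;>
      rw [h, h', h''] <;>
      first
        | exact ⟨1, Or.inl rfl, rfl⟩
        | exact ⟨-1, Or.inr rfl, rfl⟩
  obtain ⟨δ, hδ, e⟩ := e4
  refine ⟨δ, hδ, ?_⟩
  rw [← mul_assoc (u * u), e]
  simp

include hα h4 in
-- For q ≡ 5 mod 8, -1 has index 2 modulo 4, which exchanges the two pairs of adjacent classes.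
theorem neg_mem_union_quartic (h8 : Fintype.card F % 8 = 5) (i : ℕ) {w : F} (hw : w ≠ 0) :
    -w ∈ cyclotomicClass α 4 i ∪ cyclotomicClass α 4 (i + 1) ↔
      w ∉ cyclotomicClass α 4 i ∪ cyclotomicClass α 4 (i + 1) := by
  have hodd : Odd (Fintype.card F) := by rw [Nat.odd_iff]; omega
  have h1 : ind α 4 (-1 : F) = 2 := by
    rw [ind_neg_one hα hodd h4, show (2 : ZMod 4) = ((2 : ℕ) : ZMod 4) by rfl,
      ZMod.natCast_eq_natCast_iff, Nat.ModEq]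
    omega
  have h2 : ind α 4 (-w) = 2 + ind α 4 w := by
    rw [← h1, ← ind_mul hα h4 (by simp) hw]; simp
  simp only [Finset.mem_union, mem_cyclotomicClass hα h4, hw, neg_ne_zero.mpr hw, h2, ne_eq,
    not_false_eq_true, true_and, Nat.cast_add, Nat.cast_one]
  generalize (i : ZMod 4) = k
  generalize ind α 4 w = j
  revert k j
  decide

include hα h4 in
theorem diffCount_union_quartic (h8 : Fintype.card F % 8 = 5) {s : ℤ}
    (hs : (Fintype.card F : ℤ) = s ^ 2 + 4) (i : ℕ) {w : F} (hw : w ≠ 0) :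
    4 * diffCount (cyclotomicClass α 4 i ∪ cyclotomicClass α 4 (i + 1)) w + 5 = Fintype.card F ∨
      4 * diffCount (cyclotomicClass α 4 i ∪ cyclotomicClass α 4 (i + 1)) w + 1 =
        Fintype.card F := by
  set C := cyclotomicClass α 4 i ∪ cyclotomicClass α 4 (i + 1) with hC
  have h0 : (0 : F) ∉ C := by
    rw [hC, Finset.mem_union]
    exact not_or.mpr ⟨zero_notMem_cyclotomicClass, zero_notMem_cyclotomicClass⟩
  obtain ⟨δ, hδ, hA⟩ := sum_signFun_mul_union_quartic hα h4 i hw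
  rw [← hC, sum_signFun_mul h0 (sum_signFun_union_quartic hα h4 i) hw] at hA
  have hneg := neg_mem_union_quartic hα h4 h8 i hw
  rw [← hC] at hneg
  have hone : ((if w ∈ C then 1 else 0 : ℤ) + if -w ∈ C then 1 else 0) = 1 := by
    by_cases h : w ∈ C <;> simp [hneg, h]
  rw [hone] at hA
  have hnorm := norm_jacobiSum_quarticChar hα h4
  obtain ⟨p, hchar, n, hp, hq⟩ := FiniteField.card' F
  have hp4 : p % 4 = 1 := by
    have hp8 : p % 8 = 1 ∨ p % 8 = 3 ∨ p % 8 = 5 ∨ p % 8 = 7 := by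
      have hpo : Odd p := by
        refine hp.odd_of_ne_two fun h => ?_
        rw [h] at hq
        have : 2 ∣ 2 ^ (n : ℕ) := dvd_pow_self 2 n.ne_zero
        omega
      rw [Nat.odd_iff] at hpo; omega
    have hsq : p ^ 2 % 8 = 1 := by
      rcases hp8 with h | h | h | h <;> rw [Nat.pow_mod, h]
    rcases Nat.even_or_odd' (n : ℕ) with ⟨c, hc | hc⟩
    · rw [hq, hc, pow_mul, Nat.pow_mod, hsq, one_pow] at h8
      norm_num at h8
    · rw [hq, hc, pow_succ, pow_mul, Nat.mul_mod, Nat.pow_mod, hsq, one_pow] at h8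
      norm_num at h8
      omega
  obtain ⟨m, hm, hd⟩ := exists_not_dvd_choose_three_mul hp hp4 n
  have hnd := not_dvd_jacobiSum_quarticChar hα h4 (hq.trans hm) hd
  set J := jacobiSum (quarticChar hα h4) (quarticChar hα h4)
  have hcases := sq_eq_four_of_sum_two_squares (s := s) hp (by rintro rfl; omega) n.ne_zero
    (by rw [hnorm, hq]; push_cast; rfl) (by rw [← hs, hq]; push_cast; rfl) hnd
  -- The correlation identity reads 4d - q + 2 = -1 ± Im J with q odd. This parity excludes (Re J)²
  -- = 4.
  have hbeven : Even J.im := by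
    rcases hδ with rfl | rfl <;> rw [Int.even_iff] <;> omega
  have hb : J.im ^ 2 = 4 := by
    refine hcases.resolve_right fun ha => ?_
    have : Even (Fintype.card F : ℤ) := by
      rw [← hnorm, ha]
      exact Even.add (by decide) (hbeven.pow_of_ne_zero two_ne_zero)
    rw [Int.even_iff] at this
    omega
  have hb' : J.im = 2 ∨ J.im = -2 := sq_eq_sq_iff_eq_or_eq_neg.mp (by rw [hb]; norm_num)
  rcases hδ with rfl | rfl <;> rcases hb' with h | h <;> rw [h] at hA <;> omega

end Quartic

/-! ### Case (2): octic classes and line sums -/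

section Octic

/-- The even part of the sign pattern of the octic classes `0, 1, 2, 5`. -/
def octicEven : ZMod 8 → ℤ := ![0, 1, 0, -1, 0, 1, 0, -1]

/-- The odd part of the sign pattern of the octic classes `0, 1, 2, 5`. -/
def octicOdd : ZMod 8 → ℤ := ![1, 0, 1, 0, -1, 0, -1, 0]

/-- The function on `ZMod 8` that extends the sign character of `{0, 4}` by zero. -/
def octicSign : ZMod 8 → ℤ := ![1, 0, 0, 0, -1, 0, 0, 0]

theorem octicOdd_add_four (k : ZMod 8) : octicOdd (4 + k) = -octicOdd k := by
  revert k; decide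

theorem octicEven_add_four (k : ZMod 8) : octicEven (4 + k) = octicEven k := by
  revert k; decide

theorem octicOdd_add_eq (x j : ZMod 8) :
    octicOdd (x + j) = octicSign (x - -j) + octicSign (x - (2 - j)) := by
  revert x j; decide

theorem octicSign_sub_add_four (x i : ZMod 8) : octicSign (x - (i + 4)) = -octicSign (x - i) := by
  revert x i; decide

/-- As 3 · 3 = 1 in `ZMod 8`, the left argument is 3 times the right one, and multiplication by 3
fixes 0 and 4. -/
theorem octicSign_three_mul (y i : ZMod 8) :
    octicSign (3 * y + 4 - i) = octicSign (y - (3 * i + 4)) := by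
  revert y i; decide

theorem pow_val_eq_sum_octicSign {R : Type*} [CommRing R] {z : R} (hz : z ^ 4 = -1) (y : ZMod 8) :
    z ^ y.val = octicSign (y - 0) + octicSign (y - 1) * z + octicSign (y - 2) * z ^ 2 +
      octicSign (y - 3) * z ^ 3 := by
  have hs : ∀ y : ZMod 8, ∃ (i : Fin 4) (e : Fin 2), y.val = i + 4 * e ∧
      octicSign (y - 0) = (if i = 0 then (-1) ^ (e : ℕ) else 0) ∧
      octicSign (y - 1) = (if i = 1 then (-1) ^ (e : ℕ) else 0) ∧
      octicSign (y - 2) = (if i = 2 then (-1) ^ (e : ℕ) else 0) ∧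
      octicSign (y - 3) = (if i = 3 then (-1) ^ (e : ℕ) else 0) := by decide
  obtain ⟨i, e, h, h0, h1, h2, h3⟩ := hs y
  rw [h, h0, h1, h2, h3, pow_add, pow_mul, hz]
  fin_cases i <;> simp <;> ring

variable {F : Type*} [Field F] [Fintype F] [DecidableEq F] {α : Fˣ} {l : ℕ}

theorem ind_octic_neg_one (hα : Subgroup.zpowers α = ⊤) {m : ℕ}
    (hq : Fintype.card F = (8 * m + 3) ^ 2) : ind α 8 (-1 : F) = 4 := by
  have h8 : Fintype.card F = 8 * ((4 * m + 1) * (2 * m + 1)) + 1 := by rw [hq]; ring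
  rw [ind_neg_one hα ⟨4 * ((4 * m + 1) * (2 * m + 1)), by omega⟩ ⟨_, by rw [h8]; rfl⟩,
    show (4 : ZMod 8) = ((4 : ℕ) : ZMod 8) by rfl, ZMod.natCast_eq_natCast_iff, Nat.ModEq,
    show (Fintype.card F - 1) / 2 = 8 * (4 * (m * m) + 3 * m) + 4 by
      rw [show Fintype.card F - 1 = 2 * (8 * (4 * (m * m) + 3 * m) + 4) by
        rw [h8, Nat.add_sub_cancel]; ring]
      simp]
  omega

theorem ind_octic_fixedSubfield (hα : Subgroup.zpowers α = ⊤) (h8 : 8 ∣ Fintype.card F - 1)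
    (hl : IsPrimePow l) (hl8 : l % 8 = 3) (hq : Fintype.card F = l ^ 2)
    {a : F} (ha : a ∈ fixedSubfield hl hq) (ha0 : a ≠ 0) :
    ind α 8 a = 0 ∨ ind α 8 a = 4 := by
  rw [mem_fixedSubfield_iff hα hl hq ha0] at ha
  obtain ⟨n, rfl⟩ := exists_eq_pow hα ha0
  rw [ind_pow hα (succ_dvd_card_sub_one hq), ZMod.natCast_eq_zero_iff] at ha
  rw [ind_pow hα h8]
  have h4 : 4 ∣ n := dvd_trans ⟨(l + 1) / 4, by omega⟩ ha
  rw [show (4 : ZMod 8) = ((4 : ℕ) : ZMod 8) by rfl, show (0 : ZMod 8) = ((0 : ℕ) : ZMod 8) by rfl,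
    ZMod.natCast_eq_natCast_iff, ZMod.natCast_eq_natCast_iff, Nat.ModEq, Nat.ModEq]
  omega

variable (hα : Subgroup.zpowers α = ⊤) (hl : IsPrimePow l) (hl8 : l % 8 = 3)
  (hq : Fintype.card F = l ^ 2)

/-- The fourth root of unity `α ^ ((q - 1) / 4)`. -/
def quarterPow (α : Fˣ) : F := (α : F) ^ ((Fintype.card F - 1) / 4)

include hα hl8 hq in
theorem sq_quarterPow : quarterPow α ^ 2 = -1 := by
  have hodd : Odd (Fintype.card F) := by
    rw [hq]; exact Odd.pow (by rw [Nat.odd_iff]; omega)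
  have h8 := eight_dvd_card_sub_one hodd hq
  rw [quarterPow, ← pow_mul, show (Fintype.card F - 1) / 4 * 2 = (Fintype.card F - 1) / 2 by omega,
    generator_pow_half hα hodd]

include hα hl8 hq in
theorem quarterPow_pow : quarterPow α ^ l = -quarterPow α := by
  have h := sq_quarterPow hα hl8 hq
  have e : quarterPow α ^ l = (quarterPow α ^ 2) ^ (2 * (2 * (l / 8))) * quarterPow α ^ 3 := by
    rw [← pow_mul, ← pow_add]; congr 1; omega
  have h3 : quarterPow α ^ 3 = -quarterPow α := by linear_combination quarterPow α * h
  rw [e, h, h3, pow_mul]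
  norm_num

include hα hl8 in
theorem quarterPow_notMem : quarterPow α ∉ fixedSubfield hl hq := by
  rw [mem_fixedSubfield, quarterPow_pow hα hl8 hq]
  intro h
  have h1 := sq_quarterPow hα hl8 hq
  have h2 : (2 : F) * quarterPow α = 0 := by linear_combination -h
  have hodd : Odd (Fintype.card F) := by
    rw [hq]; exact Odd.pow (by rw [Nat.odd_iff]; omega)
  have h3 : (2 : F) ≠ 0 := by
    intro h3
    obtain ⟨k, hk⟩ := hodd
    have := FiniteField.cast_card_eq_zero F
    rw [hk] at this
    push_cast at this
    rw [h3] at this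
    simp at this
  rw [(mul_eq_zero.mp h2).resolve_left h3] at h1
  norm_num at h1

/-- The distribution of the octic classes along the line `i + K`. -/
noncomputable def lineSum (α : Fˣ) (hl : IsPrimePow l) (hq : Fintype.card F = l ^ 2)
    [Fintype (fixedSubfield hl hq)] (i : ZMod 8) : ℤ :=
  ∑ b : fixedSubfield hl hq, octicSign (ind α 8 (quarterPow α + b) - i)

variable [Fintype (fixedSubfield hl hq)]

theorem lineSum_add_four (i : ZMod 8) : lineSum α hl hq (i + 4) = -lineSum α hl hq i := by
  simp only [lineSum, octicSign_sub_add_four, Finset.sum_neg_distrib]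

include hα hl8 in
-- With τ = `quarterPow α`, x ↦ x^l sends τ + b to -(τ - b). It multiplies indices by l ≡ 3, and -1
-- has index 4.
theorem lineSum_three_mul (i : ZMod 8) : lineSum α hl hq (3 * i + 4) = lineSum α hl hq i := by
  have hodd : Odd (Fintype.card F) := by
    rw [hq]; exact Odd.pow (by rw [Nat.odd_iff]; omega)
  have h8 := eight_dvd_card_sub_one hodd hq
  have hτ := quarterPow_notMem hα hl hl8 hq
  have h1 : lineSum α hl hq i =
      ∑ b : fixedSubfield hl hq, octicSign (ind α 8 (quarterPow α + (-b : fixedSubfield hl hq)) - i) :=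
    (Equiv.sum_comp (Equiv.neg (fixedSubfield hl hq))
      fun b => octicSign (ind α 8 (quarterPow α + b) - i)).symm
  rw [h1, lineSum]
  refine Finset.sum_congr rfl fun b _ => ?_
  rw [← octicSign_three_mul]
  congr 2
  have hb : (b : F) ^ l = b := b.2
  have e : (quarterPow α + b) ^ l = -1 * (quarterPow α + (-b : fixedSubfield hl hq)) := by
    rw [add_pow_of_card_eq_sq hl hq, quarterPow_pow hα hl8 hq, hb]; push_cast; ring
  have e2 := congrArg (ind α 8) e
  have hl' : (l : ZMod 8) = 3 := by
    rw [show (3 : ZMod 8) = ((3 : ℕ) : ZMod 8) by rfl, ZMod.natCast_eq_natCast_iff]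
    exact hl8
  rw [ind_pow_apply hα h8 (add_ne_zero_of_notMem hτ b),
    ind_mul hα h8 (by simp) (add_ne_zero_of_notMem hτ (-b)),
    ind_octic_neg_one hα (m := l / 8) (by rw [hq]; congr 1; omega), hl'] at e2
  rw [e2]
  generalize ind α 8 (quarterPow α + (-b : fixedSubfield hl hq)) = y
  revert y; decide

include hα hl8 in
theorem lineSum_zero : lineSum α hl hq 0 = 0 := by
  have h1 := lineSum_three_mul hα hl hl8 hq 0
  rw [mul_zero, lineSum_add_four] at h1
  omega

include hα hl8 in
theorem lineSum_three : lineSum α hl hq 3 = -lineSum α hl hq 1 := by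
  have h1 := lineSum_three_mul hα hl hl8 hq 1
  have h2 := lineSum_add_four (α := α) hl hq 3
  rw [show (3 : ZMod 8) * 1 + 4 = 3 + 4 by decide] at h1
  omega

include hα hl8 in
/-- The sum of the odd part along an affine line, by the octic class of its direction. -/
theorem sum_octicOdd_line {w : F} (hw : w ≠ 0) :
    ∑ b : fixedSubfield hl hq, indFun α 8 octicOdd ((quarterPow α + b) * w) =
      lineSum α hl hq (-ind α 8 w) + lineSum α hl hq (2 - ind α 8 w) := by
  have hodd : Odd (Fintype.card F) := by
    rw [hq]; exact Odd.pow (by rw [Nat.odd_iff]; omega)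
  have h8 := eight_dvd_card_sub_one hodd hq
  have hτ := quarterPow_notMem hα hl hl8 hq
  rw [lineSum, lineSum, ← Finset.sum_add_distrib]
  refine Finset.sum_congr rfl fun b _ => ?_
  have hb := add_ne_zero_of_notMem hτ b
  rw [indFun_of_ne _ (mul_ne_zero hb hw), ind_mul hα h8 hb hw, octicOdd_add_eq]

include hα hl8 in
-- Let Nᵢ be the line sums. Since N₀ = 0 and N₃ = -N₁, the sum is ±N₂ for even j, and for odd j it
-- is ±2N₁ or 0 as `octicEven j` is 1 or -1; the right side interpolates these squares.
theorem sq_lineSum_add (j : ZMod 8) :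
    (lineSum α hl hq (-j) + lineSum α hl hq (2 - j)) ^ 2 =
      (1 - octicEven j ^ 2) * lineSum α hl hq 2 ^ 2 +
        2 * (octicEven j ^ 2 + octicEven j) * lineSum α hl hq 1 ^ 2 := by
  have h0 := lineSum_zero hα hl hl8 hq
  have h3 := lineSum_three hα hl hl8 hq
  have h4 : lineSum α hl hq 4 = _ := lineSum_add_four hl hq 0
  have h5 : lineSum α hl hq 5 = _ := lineSum_add_four hl hq 1
  have h6 : lineSum α hl hq 6 = _ := lineSum_add_four hl hq 2
  have h7 : lineSum α hl hq 7 = _ := lineSum_add_four hl hq 3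
  have key : ∀ j : ZMod 8,
      (j = 0 ∧ -j = 0 ∧ 2 - j = 2 ∧ octicEven j = 0) ∨
      (j = 1 ∧ -j = 7 ∧ 2 - j = 1 ∧ octicEven j = 1) ∨
      (j = 2 ∧ -j = 6 ∧ 2 - j = 0 ∧ octicEven j = 0) ∨
      (j = 3 ∧ -j = 5 ∧ 2 - j = 7 ∧ octicEven j = -1) ∨
      (j = 4 ∧ -j = 4 ∧ 2 - j = 6 ∧ octicEven j = 0) ∨
      (j = 5 ∧ -j = 3 ∧ 2 - j = 5 ∧ octicEven j = 1) ∨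
      (j = 6 ∧ -j = 2 ∧ 2 - j = 4 ∧ octicEven j = 0) ∨
      (j = 7 ∧ -j = 1 ∧ 2 - j = 3 ∧ octicEven j = -1) := by decide
  rcases key j with h | h | h | h | h | h | h | h <;> obtain ⟨-, e1, e2, e3⟩ := h <;>
    rw [e1, e2, e3] <;> simp only [h4, h5, h6, h7, h3, h0] <;> ring

omit [Fintype (fixedSubfield hl hq)] in
theorem sq_indFun (c : ZMod 8 → ℤ) (x : F) :
    indFun α 8 c x ^ 2 = indFun α 8 (fun k => c k ^ 2) x := by
  by_cases hx : x = 0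
  · simp [hx]
  · simp [indFun_of_ne _ hx]

include hα hl8 in
theorem two_mul_sum_octicOdd_mul {w : F} (hw : w ≠ 0) :
    2 * ∑ x, indFun α 8 octicOdd x * indFun α 8 octicOdd (x + w) =
      2 * (lineSum α hl hq (-ind α 8 w) + lineSum α hl hq (2 - ind α 8 w)) ^ 2 - (l + 1) := by
  have hodd : Odd (Fintype.card F) := by
    rw [hq]; exact Odd.pow (by rw [Nat.odd_iff]; omega)
  have h8 := eight_dvd_card_sub_one hodd hq
  have hK := card_fixedSubfield hα hl hq
  have hτ := quarterPow_notMem hα hl hl8 hq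
  have hmul (a : F) (x : F) (ha : a ∈ fixedSubfield hl hq) (ha0 : a ≠ 0) :
      indFun α 8 octicOdd (a * x) = octicSign (ind α 8 a) * indFun α 8 octicOdd x := by
    rw [indFun_mul hα h8 _ ha0]
    by_cases hx : x = 0
    · simp [hx]
    · rw [indFun_of_ne _ hx, indFun_of_ne _ hx]
      rcases ind_octic_fixedSubfield hα h8 hl hl8 hq ha ha0 with h | h
      · rw [h, zero_add]; simp [octicSign]
      · rw [h, octicOdd_add_four, show octicSign 4 = -1 by decide]; ring
  have h1 := sum_mul_add_plane (K := fixedSubfield hl hq) (f := indFun α 8 octicOdd)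
    (ε := fun a => octicSign (ind α 8 (a : F))) hτ
    (by rw [hK, hq]) (by simp)
    (fun a ha => by
      rcases ind_octic_fixedSubfield hα h8 hl hl8 hq a.2 (by simpa using ha) with h | h <;>
        rw [h] <;> decide)
    (fun a x ha => hmul a x a.2 (by simpa using ha)) hw
  -- α^(l+1) lies in K and has index 4 modulo 8, so multiplying by it negates the sum.
  have hline : ∑ b : fixedSubfield hl hq, indFun α 8 octicOdd (b * w) = 0 := by
    have ha0 : (α : F) ^ (l + 1) ≠ 0 := by simp
    have ha : (α : F) ^ (l + 1) ∈ fixedSubfield hl hq := by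
      rw [mem_fixedSubfield_iff hα hl hq ha0, ind_pow hα (succ_dvd_card_sub_one hq)]
      simp
    have hind : ind α 8 ((α : F) ^ (l + 1)) = 4 := by
      rw [ind_pow hα h8, show (4 : ZMod 8) = ((4 : ℕ) : ZMod 8) by rfl,
        ZMod.natCast_eq_natCast_iff, Nat.ModEq]
      omega
    have h2 : ∑ b : fixedSubfield hl hq, indFun α 8 octicOdd (b * w) =
        ∑ b : fixedSubfield hl hq, -indFun α 8 octicOdd (b * w) := by
      rw [← Equiv.sum_comp (Equiv.mulLeft₀ (⟨_, ha⟩ : fixedSubfield hl hq)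
        (by simp [Subtype.ext_iff]))]
      refine Finset.sum_congr rfl fun b _ => ?_
      have : (((Equiv.mulLeft₀ (⟨_, ha⟩ : fixedSubfield hl hq)
        (by simp [Subtype.ext_iff])) b : fixedSubfield hl hq) : F) * w =
          (α : F) ^ (l + 1) * (b * w) := by
        simp [mul_assoc]
      rw [this, hmul _ _ ha ha0, hind, show octicSign 4 = -1 by decide]
      ring
    rw [Finset.sum_neg_distrib] at h2
    omega
  have hsq := sum_indFun hα h8 fun k => octicOdd k ^ 2
  rw [show ∑ k, octicOdd k ^ 2 = 4 by decide] at hsq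
  rw [sum_octicOdd_line hα hl hl8 hq hw, hline, hK] at h1
  simp only [sq_indFun] at h1
  have hl1 := hl.one_lt
  have hne : (l : ℤ) - 1 ≠ 0 := by omega
  apply mul_left_cancel₀ hne
  rw [hq] at hsq
  push_cast at hsq
  linarith

omit [Fintype (fixedSubfield hl hq)] in
include hα hl hl8 hq in
theorem two_mul_sum_octicEven_mul {w : F} (hw : w ≠ 0) :
    2 * ∑ x, indFun α 8 octicEven x * indFun α 8 octicEven (x + w) =
      2 * l * octicEven (ind α 8 w) ^ 2 - (l + 1) := by
  classical
  have hodd : Odd (Fintype.card F) := by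
    rw [hq]; exact Odd.pow (by rw [Nat.odd_iff]; omega)
  have h8 := eight_dvd_card_sub_one hodd hq
  have hK := card_fixedSubfield hα hl hq
  have hs := sum_indFun hα h8 octicEven
  rw [show ∑ k, octicEven k = 0 by decide, mul_zero] at hs
  have h1 := sum_mul_add_of_invariant (K := fixedSubfield hl hq) (f := indFun α 8 octicEven)
    (quarterPow_notMem hα hl hl8 hq) (by rw [hK, hq]) (by simp)
    (fun a x ha => by
      have ha0 : (a : F) ≠ 0 := by simpa using ha
      rw [indFun_mul hα h8 _ ha0]
      by_cases hx : x = 0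
      · simp [hx]
      · rw [indFun_of_ne _ hx, indFun_of_ne _ hx]
        rcases ind_octic_fixedSubfield hα h8 hl hl8 hq a.2 ha0 with h | h
        · rw [h, zero_add]
        · rw [h, octicEven_add_four])
    (by push_cast at hs; omega) hw
  have hsq := sum_indFun hα h8 fun k => octicEven k ^ 2
  rw [show ∑ k, octicEven k ^ 2 = 4 by decide] at hsq
  rw [hK, indFun_of_ne _ hw] at h1
  simp only [sq_indFun] at h1
  have hl1 := hl.one_lt
  have hne : (l : ℤ) - 1 ≠ 0 := by omega
  apply mul_left_cancel₀ hne
  rw [hq] at hsq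
  push_cast at hsq
  linarith

include hα hl8 in
-- The autocorrelation of h summed over all w is (∑ h)² = 0; the terms w ≠ 0 are known by class, and
-- w = 0 gives ∑ h².
theorem sq_lineSum_two_add :
    lineSum α hl hq 2 ^ 2 + 2 * lineSum α hl hq 1 ^ 2 = l := by
  have hodd : Odd (Fintype.card F) := by
    rw [hq]; exact Odd.pow (by rw [Nat.odd_iff]; omega)
  have h8 := eight_dvd_card_sub_one hodd hq
  set h : F → ℤ := indFun α 8 octicOdd with hh
  have hs : ∑ x, h x = 0 := by
    have := sum_indFun hα h8 octicOdd
    rw [show ∑ k, octicOdd k = 0 by decide, mul_zero] at this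
    exact (mul_eq_zero.mp this).resolve_left (by norm_num)
  have hsq : 8 * ∑ x, h x * h x = ((Fintype.card F : ℤ) - 1) * 4 := by
    have := sum_indFun hα h8 fun k => octicOdd k ^ 2
    rw [show ∑ k, octicOdd k ^ 2 = 4 by decide] at this
    rw [Finset.sum_congr rfl fun x _ => by rw [← sq, hh, sq_indFun]]
    exact this
  have htot : ∑ w, ∑ x, h x * h (x + w) = 0 := by
    rw [Finset.sum_comm]
    have (x : F) : ∑ w, h x * h (x + w) = 0 := by
      rw [← Finset.mul_sum, Fintype.sum_equiv (Equiv.addLeft x) (fun w => h (x + w)) h fun _ => rfl,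
        hs, mul_zero]
    simp [this]
  set c : ZMod 8 → ℤ := fun j =>
    2 * (lineSum α hl hq (-j) + lineSum α hl hq (2 - j)) ^ 2 - (l + 1) with hc
  have hcs : ∑ j, c j = 2 * (4 * lineSum α hl hq 2 ^ 2 + 8 * lineSum α hl hq 1 ^ 2) - 8 * (l + 1) := by
    have e1 : ∑ j, (1 - octicEven j ^ 2) = 4 := by decide
    have e2 : ∑ j, 2 * (octicEven j ^ 2 + octicEven j) = 8 := by decide
    simp only [hc, sq_lineSum_add hα hl hl8 hq, Finset.sum_sub_distrib, ← Finset.mul_sum,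
      Finset.sum_add_distrib, ← Finset.sum_mul, Finset.sum_const, Finset.card_univ, ZMod.card,
      nsmul_eq_mul] at e1 e2 ⊢
    rw [e1, e2]
    push_cast
    ring
  have hw (w : F) : 2 * ∑ x, h x * h (x + w) =
      indFun α 8 c w + if w = 0 then 2 * ∑ x, h x * h x else 0 := by
    by_cases hw : w = 0
    · simp [hw]
    · rw [two_mul_sum_octicOdd_mul hα hl hl8 hq hw, indFun_of_ne _ hw, if_neg hw, add_zero]
  have hci := sum_indFun hα h8 c
  rw [hcs] at hci
  have h1 : 2 * ∑ w, ∑ x, h x * h (x + w) = ∑ w : F, indFun α 8 c w + 2 * ∑ x, h x * h x := by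
    rw [Finset.mul_sum, Finset.sum_congr rfl fun w _ => hw w, Finset.sum_add_distrib]
    simp
  rw [htot] at h1
  have hq1 : (Fintype.card F : ℤ) - 1 ≠ 0 := by
    have := Fintype.one_lt_card (α := F); omega
  apply mul_left_cancel₀ hq1
  push_cast at hci
  linarith

end Octic

/-! ### Case (2): primitivity of the representation of l, and the difference count -/

section OcticAdesign

variable {F : Type*} [Field F] [Fintype F] [DecidableEq F] {α : Fˣ} {l : ℕ}
  (hα : Subgroup.zpowers α = ⊤) (hl : IsPrimePow l) (hl8 : l % 8 = 3)
  (hq : Fintype.card F = l ^ 2)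

include hα hl8 in
/-- A power sum along the line `i + K` does not vanish, by evaluation of a binomial coefficient. -/
theorem sum_line_pow_ne_zero [Fintype (fixedSubfield hl hq)] {p m : ℕ} [CharP F p]
    (hm : l = 8 * m + 3) (hd : ¬ p ∣ (4 * m + 1).choose m) :
    ∑ b : fixedSubfield hl hq, (quarterPow α + (b : F)) ^ (7 * ((4 * m + 1) * (2 * m + 1))) ≠ 0 := by
  set M := 7 * ((4 * m + 1) * (2 * m + 1)) with hM
  intro h0
  have hK := card_fixedSubfield hα hl hq
  have hτ := quarterPow_notMem hα hl hl8 hq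
  have hcard : Fintype.card F - 1 = 8 * ((4 * m + 1) * (2 * m + 1)) := by
    rw [hq, hm, show (8 * m + 3) ^ 2 = 8 * ((4 * m + 1) * (2 * m + 1)) + 1 by ring,
      Nat.add_sub_cancel]
  -- The factor x - x^l vanishes on K and equals 2aτ at x = a(τ + b), independently of b, so the
  -- power sum along the line factors out.
  have h1 : ∑ x : F, x ^ M * (x - x ^ l) ^ (4 * m + 1) = 0 := by
    rw [sum_plane hτ (by rw [hK, hq]) (one_ne_zero (α := F))]
    have e1 (b : fixedSubfield hl hq) :
        ((b : F) * 1) ^ M * ((b : F) * 1 - ((b : F) * 1) ^ l) ^ (4 * m + 1) = 0 := by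
      have hb : (b : F) ^ l = b := b.2
      rw [mul_one, hb, sub_self, zero_pow (by omega), mul_zero]
    have e2 (a b : fixedSubfield hl hq) :
        ((a : F) * ((quarterPow α + b) * 1)) ^ M * ((a : F) * ((quarterPow α + b) * 1) -
          ((a : F) * ((quarterPow α + b) * 1)) ^ l) ^ (4 * m + 1) =
        (a : F) ^ M * (2 * a * quarterPow α) ^ (4 * m + 1) * (quarterPow α + b) ^ M := by
      have ha : (a : F) ^ l = a := a.2
      have hb : (b : F) ^ l = b := b.2
      rw [mul_one, mul_pow _ _ l, add_pow_of_card_eq_sq hl hq, quarterPow_pow hα hl8 hq, ha, hb,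
        mul_pow _ _ M, show (a : F) * (quarterPow α + b) - a * (-quarterPow α + b) =
          2 * a * quarterPow α by ring]
      ring
    simp only [e1, e2, ← Finset.mul_sum, h0]
    simp
  have h2 : ∑ x : F, x ^ M * (x - x ^ l) ^ (4 * m + 1) =
      ∑ x : F, ∑ j ∈ Finset.range (4 * m + 1 + 1),
        ((-1) ^ j * ((4 * m + 1).choose j : F)) * x ^ (M + (4 * m + 1) * (1 + 2 * j)) := by
    refine Finset.sum_congr rfl fun x _ => ?_
    rw [sub_eq_neg_add, add_pow, Finset.mul_sum]
    refine Finset.sum_congr rfl fun j hj => ?_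
    rw [Finset.mem_range] at hj
    have e : M + (4 * m + 1) * (1 + 2 * j) = M + l * j + (4 * m + 1 - j) := by
      zify [show j ≤ 4 * m + 1 by omega]
      rw [hm]; push_cast; ring
    rw [e, neg_pow, ← pow_mul, pow_add, pow_add]
    ring
  rw [h2, sum_sum_pow_eq (fun j => (-1) ^ j * ((4 * m + 1).choose j : F))
    (fun j => M + (4 * m + 1) * (1 + 2 * j)) (j₀ := m) (by simp; omega)
    (fun j _ => by
      have : 0 < (4 * m + 1) * (1 + 2 * j) := by positivity
      omega)
    ⟨1, by rw [hcard, hM]; ring⟩ ?_, neg_eq_zero, mul_eq_zero] at h1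
  · rcases h1 with h | h
    · exact absurd h (pow_ne_zero _ (by simp))
    · exact hd ((CharP.cast_eq_zero_iff F p _).mp h)
  -- After cancelling 4m + 1 the condition is 16m + 8 ∣ 14m + 8 + 2j with j ≤ 4m + 1, which leaves
  -- only j = m.
  · intro j hj hdj
    rw [Finset.mem_range] at hj
    rw [hcard, hM, show 7 * ((4 * m + 1) * (2 * m + 1)) + (4 * m + 1) * (1 + 2 * j) =
      (4 * m + 1) * (14 * m + 8 + 2 * j) by ring,
      show 8 * ((4 * m + 1) * (2 * m + 1)) = (4 * m + 1) * (16 * m + 8) by ring,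
      Nat.mul_dvd_mul_iff_left (by omega)] at hdj
    obtain ⟨c, hc⟩ := hdj
    have hc1 : c < 2 := by
      by_contra! h
      have := Nat.mul_le_mul_left (16 * m + 8) h
      omega
    have hc0 : c ≠ 0 := by rintro rfl; omega
    obtain rfl : c = 1 := by omega
    omega

include hα hl8 in
-- With z = α^M, z⁴ = -1, the power sum along the line is N₁(z - z³) + N₂z² in F; it would vanish if
-- p divided both N₁ and N₂.
theorem not_dvd_lineSum [Fintype (fixedSubfield hl hq)] {p m : ℕ} [CharP F p]
    (hm : l = 8 * m + 3) (hd : ¬ p ∣ (4 * m + 1).choose m) :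
    ¬ ((p : ℤ) ∣ lineSum α hl hq 2 ∧ (p : ℤ) ∣ lineSum α hl hq 1) := by
  rintro ⟨h2, h1⟩
  apply sum_line_pow_ne_zero hα hl hl8 hq hm hd
  have hodd : Odd (Fintype.card F) := by
    rw [hq]; exact Odd.pow (by rw [Nat.odd_iff]; omega)
  have h8 := eight_dvd_card_sub_one hodd hq
  have hτ := quarterPow_notMem hα hl hl8 hq
  set M := 7 * ((4 * m + 1) * (2 * m + 1)) with hM
  have hcard : Fintype.card F - 1 = 8 * ((4 * m + 1) * (2 * m + 1)) := by
    rw [hq, hm, show (8 * m + 3) ^ 2 = 8 * ((4 * m + 1) * (2 * m + 1)) + 1 by ring,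
      Nat.add_sub_cancel]
  set z : F := (α : F) ^ M with hz
  have hz4 : z ^ 4 = -1 := by
    rw [hz, ← pow_mul, show M * 4 = (Fintype.card F - 1) / 2 * 7 by omega, pow_mul,
      generator_pow_half hα hodd]
    norm_num
  have hpow (x : F) (hx : x ≠ 0) : x ^ M = z ^ (ind α 8 x).val := by
    obtain ⟨n, rfl⟩ := exists_eq_pow hα hx
    have hz8 : z ^ 8 = 1 := by
      rw [show 8 = 4 * 2 by rfl, pow_mul, hz4]; norm_num
    rw [ind_pow hα h8, ZMod.val_natCast, ← pow_eq_pow_mod n hz8, hz, ← pow_mul, ← pow_mul, mul_comm]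
  have e : ∑ b : fixedSubfield hl hq, (quarterPow α + (b : F)) ^ M =
      (lineSum α hl hq 0 : F) + (lineSum α hl hq 1 : F) * z + (lineSum α hl hq 2 : F) * z ^ 2 +
        (lineSum α hl hq 3 : F) * z ^ 3 := by
    simp only [lineSum, Int.cast_sum, Finset.sum_mul, ← Finset.sum_add_distrib]
    refine Finset.sum_congr rfl fun b _ => ?_
    rw [hpow _ (add_ne_zero_of_notMem hτ b), pow_val_eq_sum_octicSign hz4]
  have c1 : ((lineSum α hl hq 1 : ℤ) : F) = 0 := (CharP.intCast_eq_zero_iff F p _).mpr h1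
  have c2 : ((lineSum α hl hq 2 : ℤ) : F) = 0 := (CharP.intCast_eq_zero_iff F p _).mpr h2
  rw [e, lineSum_zero hα hl hl8 hq, lineSum_three hα hl hl8 hq]
  push_cast
  rw [c1, c2]
  ring

include hα hl8 in
theorem sq_lineSum_one [Fintype (fixedSubfield hl hq)] {t : ℕ} (ht : l = t ^ 2 + 2) :
    lineSum α hl hq 1 ^ 2 = 1 := by
  obtain ⟨p, n, hp, hchar, hn, hpn⟩ := exists_prime_pow_of_card_eq_sq hl hq
  have hpo : p % 8 = 1 ∨ p % 8 = 3 ∨ p % 8 = 5 ∨ p % 8 = 7 := by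
    have : Odd p := by
      refine hp.odd_of_ne_two fun h => ?_
      have h2 : 2 ∣ l := by rw [hpn, h]; exact dvd_pow_self 2 hn.ne'
      omega
    rw [Nat.odd_iff] at this; omega
  have hsq : p ^ 2 % 8 = 1 := by
    rcases hpo with h | h | h | h <;> rw [Nat.pow_mod, h]
  rcases Nat.even_or_odd' n with ⟨c, hc | hc⟩
  · rw [hpn, hc, pow_mul, Nat.pow_mod, hsq, one_pow] at hl8
    norm_num at hl8
  · have hp8 : p % 8 = 3 := by
      have h := hl8
      rw [hpn, hc, pow_succ, pow_mul, Nat.mul_mod, Nat.pow_mod, hsq, one_pow] at h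
      norm_num at h
      exact h
    obtain ⟨m, hm, hd⟩ := exists_not_dvd_choose_of_mod_eight hp hp8 c
    refine sq_eq_one_of_sq_add_two_mul_sq (t := t) hp (by rintro rfl; omega) hn.ne' ?_ ?_
      (not_dvd_lineSum hα hl hl8 hq (by rw [hpn, hc, hm]) hd)
    · rw [sq_lineSum_two_add hα hl hl8 hq, hpn]; push_cast; rfl
    · have : ((l : ℕ) : ℤ) = (t : ℤ) ^ 2 + 2 := by rw [ht]; push_cast; rfl
      rw [← this, hpn]; push_cast; rfl

theorem union_octic_eq_biUnion (α : Fˣ) :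
    cyclotomicClass α 8 0 ∪ cyclotomicClass α 8 1 ∪ cyclotomicClass α 8 2 ∪ cyclotomicClass α 8 5 =
      ({0, 1, 2, 5} : Finset ℕ).biUnion fun i => cyclotomicClass α 8 i := by
  ext x
  simp only [Finset.mem_union, Finset.mem_biUnion, Finset.mem_insert, Finset.mem_singleton,
    exists_eq_or_imp, exists_eq_left, or_assoc]

include hα in
theorem signFun_union_octic (h8 : 8 ∣ Fintype.card F - 1) (x : F) :
    signFun (({0, 1, 2, 5} : Finset ℕ).biUnion fun i => cyclotomicClass α 8 i) x =
      indFun α 8 octicEven x + indFun α 8 octicOdd x := by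
  rw [signFun_biUnion hα h8]
  by_cases hx : x = 0
  · simp [hx]
  · rw [indFun_of_ne _ hx, indFun_of_ne _ hx, indFun_of_ne _ hx]
    generalize ind α 8 x = k
    revert k
    decide

include hα hl hl8 hq in
theorem diffCount_union_octic {t : ℕ} (ht : l = t ^ 2 + 2) {w : F} (hw : w ≠ 0) :
    4 * diffCount (({0, 1, 2, 5} : Finset ℕ).biUnion fun i => cyclotomicClass α 8 i) w + 5 =
        Fintype.card F ∨
      4 * diffCount (({0, 1, 2, 5} : Finset ℕ).biUnion fun i => cyclotomicClass α 8 i) w + 1 =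
        Fintype.card F := by
  classical
  have hodd : Odd (Fintype.card F) := by
    rw [hq]; exact Odd.pow (by rw [Nat.odd_iff]; omega)
  have h8 := eight_dvd_card_sub_one hodd hq
  have hm1 : ind α 8 (-1 : F) = 4 :=
    ind_octic_neg_one hα (m := l / 8) (by rw [hq]; congr 1; omega)
  have hs := sum_signFun_biUnion hα h8 (I := {0, 1, 2, 5}) (by decide) (by decide)
  set C := ({0, 1, 2, 5} : Finset ℕ).biUnion fun i => cyclotomicClass α 8 i with hC
  have h0 : (0 : F) ∉ C := by
    rw [hC, mem_biUnion_cyclotomicClass hα h8]; simp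
  set g : F → ℤ := indFun α 8 octicEven with hg
  set h : F → ℤ := indFun α 8 octicOdd with hh
  have hsign (x : F) : signFun C x = g x + h x := signFun_union_octic hα h8 x
  have hneg (x : F) : g (-x) = g x ∧ h (-x) = -h x := by
    rw [hg, hh, ← neg_one_mul, indFun_mul hα h8 _ (by simp), indFun_mul hα h8 _ (by simp), hm1]
    by_cases hx : x = 0
    · simp [hx]
    · simp [indFun_of_ne _ hx, octicEven_add_four, octicOdd_add_four]
  -- Substitute x ↦ -w - x, with g even and h odd.
  have hcross : ∑ x, g x * h (x + w) = -∑ x, h x * g (x + w) := by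
    rw [← Finset.sum_neg_distrib]
    refine Fintype.sum_equiv (Equiv.subLeft (-w)) _ _ fun x => ?_
    have e1 : Equiv.subLeft (-w) x = -(x + w) := by simp [sub_eq_add_neg, add_comm]
    rw [e1, show -(x + w) + w = -x by ring, (hneg _).1, (hneg _).2]
    ring
  have hA := sum_signFun_mul h0 hs hw
  have hsplit : ∑ x, signFun C x * signFun C (x + w) =
      ∑ x, g x * g (x + w) + ∑ x, h x * h (x + w) := by
    have : ∑ x, signFun C x * signFun C (x + w) = ∑ x, g x * g (x + w) + ∑ x, h x * h (x + w) +
        (∑ x, g x * h (x + w) + ∑ x, h x * g (x + w)) := by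
      simp only [← Finset.sum_add_distrib, hsign]
      exact Finset.sum_congr rfl fun x _ => by ring
    rw [this, hcross]; ring
  have hind : ((if w ∈ C then 1 else 0 : ℤ) + if -w ∈ C then 1 else 0) = 1 + g w := by
    have e (x : F) (hx : x ≠ 0) : 2 * (if x ∈ C then 1 else 0 : ℤ) = 1 + (g x + h x) := by
      rw [← hsign, signFun_eq h0, if_neg hx]; ring
    have e1 := e w hw
    have e2 := e (-w) (neg_ne_zero.mpr hw)
    rw [(hneg w).1, (hneg w).2] at e2
    linarith
  have hG := two_mul_sum_octicEven_mul hα hl hl8 hq hw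
  have hH := two_mul_sum_octicOdd_mul hα hl hl8 hq hw
  have hk := sq_lineSum_two_add hα hl hl8 hq
  rw [sq_lineSum_add hα hl hl8 hq, sq_lineSum_one hα hl hl8 hq ht] at hH
  rw [sq_lineSum_one hα hl hl8 hq ht] at hk
  rw [hsplit, hind, hg, indFun_of_ne _ hw] at hA
  rw [show lineSum α hl hq 2 ^ 2 = (l : ℤ) - 2 by linarith] at hH
  have hv : octicEven (ind α 8 w) = 0 ∨ octicEven (ind α 8 w) = 1 ∨
      octicEven (ind α 8 w) = -1 := by
    generalize ind α 8 w = k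
    revert k
    decide
  generalize octicEven (ind α 8 w) = v at *
  -- With N₁² = 1 and N₂² = l - 2, all terms in l and those linear in v cancel.
  have hd : 4 * (diffCount C w : ℤ) = Fintype.card F - 5 + 4 * v ^ 2 := by
    have : 2 * (4 * (diffCount C w : ℤ)) = 2 * (Fintype.card F - 5 + 4 * v ^ 2) := by
      linear_combination -2 * hA + hG + hH
    omega
  rcases hv with hv | hv | hv <;> rw [hv] at hd <;> omega

end OcticAdesign

/-! ### Assembly of the three cases -/

section Main

theorem union_quartic_eq_biUnion {F : Type*} [Field F] [Fintype F] [DecidableEq F] (α : Fˣ)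
    (i : ℕ) : cyclotomicClass α 4 i ∪ cyclotomicClass α 4 (i + 1) =
      ({i, i + 1} : Finset ℕ).biUnion fun i => cyclotomicClass α 4 i := by
  simp [Finset.biUnion_insert]

theorem biUnion_insert_succ_ne_cyclotomicClass_two {F : Type*} [Field F] [Fintype F]
    [DecidableEq F] {α : Fˣ} (hα : Subgroup.zpowers α = ⊤) {e : ℕ} (he : e ∣ Fintype.card F - 1)
    (h2 : 2 ∣ Fintype.card F - 1) {I : Finset ℕ} {i k : ℕ} (hi : i ∈ I) (hi' : i + 1 ∈ I) :
    (I.biUnion fun i => cyclotomicClass α e i) ≠ cyclotomicClass α 2 k := by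
  rcases Nat.even_or_odd i with h | h
  · exact biUnion_ne_cyclotomicClass_two hα he h2 hi h hi' h.add_one
  · exact biUnion_ne_cyclotomicClass_two hα he h2 hi' h.add_one hi h

theorem theorem4p4 {F : Type*} [Field F] [Fintype F] [DecidableEq F]
    (hodd : Odd (Fintype.card F)) (α : Fˣ) (hα : Subgroup.zpowers α = ⊤) (C : Finset F)
    (hC :
      ((∃ i : ℕ, C = cyclotomicClass α 4 i ∪ cyclotomicClass α 4 (i + 1)) ∧
        Fintype.card F ≡ 5 [MOD 8] ∧
        ∃ s : ℤ, (Fintype.card F : ℤ) = s ^ 2 + 4 ∧ s ≡ 1 [ZMOD 4]) ∨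
      (C = cyclotomicClass α 8 0 ∪ cyclotomicClass α 8 1 ∪ cyclotomicClass α 8 2 ∪
          cyclotomicClass α 8 5 ∧
        ∃ l : ℕ, IsPrimePow l ∧ Fintype.card F = l ^ 2 ∧ l ≡ 3 [MOD 8] ∧
          ∃ t : ℕ, l = t ^ 2 + 2) ∨
      (∃ l : ℕ, IsPrimePow l ∧ Fintype.card F = l ^ 2 ∧
        ∃ I : Finset ℕ, I ⊆ Finset.range (l + 1) ∧ 2 * I.card = l + 1 ∧
          (∃ i ∈ I, Even i) ∧ (∃ j ∈ I, Odd j) ∧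
          C = I.biUnion fun i => cyclotomicClass α (l + 1) i)) :
    (∃ k μ : ℕ, 2 * k + 1 = Fintype.card F ∧ 4 * μ + 11 = 3 * Fintype.card F ∧
      IsAdesign 2 (Fintype.card F) k μ
        (development (cyclotomicClass α 2 0) + development (cyclotomicClass α 2 1) +
          development C)) ∧
    (Fintype.card F ≠ 5 →
      (Fintype.card F = 9 →
        C ≠ cyclotomicClass α 8 0 ∪ cyclotomicClass α 8 1 ∪ cyclotomicClass α 8 2 ∪
          cyclotomicClass α 8 5) →
      (development (cyclotomicClass α 2 0) + development (cyclotomicClass α 2 1) +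
        development C).Nodup) := by
  rcases hC with ⟨⟨i, rfl⟩, h5, s, hs, -⟩ | ⟨rfl, l, hl, hq, hl8, t, ht⟩ |
    ⟨l, hl, hq, I, hI, hc, ⟨i, hi, hie⟩, ⟨j, hj, hjo⟩, rfl⟩
  · have h5 : Fintype.card F % 8 = 5 := h5
    have h4 : 4 ∣ Fintype.card F - 1 := by omega
    have h0 : (0 : F) ∉ cyclotomicClass α 4 i ∪ cyclotomicClass α 4 (i + 1) := by
      rw [Finset.mem_union]
      exact not_or.mpr ⟨zero_notMem_cyclotomicClass, zero_notMem_cyclotomicClass⟩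
    have hsum := sum_signFun_union_quartic hα h4 i
    refine ⟨isAdesign_development hα h4 h0 hsum fun w hw =>
      diffCount_union_quartic hα h4 h5 hs i hw, fun hq5 _ => ?_⟩
    have h1 := Fintype.one_lt_card (α := F)
    have hne (k : ℕ) : cyclotomicClass α 4 i ∪ cyclotomicClass α 4 (i + 1) ≠
        cyclotomicClass α 2 k := by
      rw [union_quartic_eq_biUnion]
      exact biUnion_insert_succ_ne_cyclotomicClass_two hα h4 (by omega) (i := i) (by simp) (by simp)
    refine nodup_development_add hα h4 h0 hsum ?_ (hne 0) (hne 1)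
    rw [union_quartic_eq_biUnion]
    -- Requires 4 < q - 1; for q = 5, α⁴ = 1 and stability under it says nothing.
    exact sum_biUnion_eq_zero hα h4 (by norm_num) (by omega) _
  · have h8 := eight_dvd_card_sub_one hodd hq
    have h4 : 4 ∣ Fintype.card F - 1 := by omega
    have h1 := Fintype.one_lt_card (α := F)
    rw [union_octic_eq_biUnion]
    have h0 : (0 : F) ∉ ({0, 1, 2, 5} : Finset ℕ).biUnion fun i => cyclotomicClass α 8 i := by
      rw [mem_biUnion_cyclotomicClass hα h8]; simp
    have hsum := sum_signFun_biUnion hα h8 (I := {0, 1, 2, 5}) (by decide) (by decide)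
    refine ⟨isAdesign_development hα h4 h0 hsum fun w hw =>
      diffCount_union_octic hα hl hl8 hq ht hw, fun _ hq9 => ?_⟩
    -- Gives 8 < q - 1, that is α⁸ ≠ 1.
    have hq9' : Fintype.card F ≠ 9 := fun h => hq9 h rfl
    have hne (k : ℕ) := biUnion_insert_succ_ne_cyclotomicClass_two (k := k) hα h8 (by omega)
      (I := {0, 1, 2, 5}) (i := 0) (by simp) (by simp)
    exact nodup_development_add hα h4 h0 hsum
      (sum_biUnion_eq_zero hα h8 (by norm_num) (by omega) _) (hne 0) (hne 1)
  · have h8 := eight_dvd_card_sub_one hodd hq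
    have h4 : 4 ∣ Fintype.card F - 1 := by omega
    have he := succ_dvd_card_sub_one hq
    have h0 : (0 : F) ∉ I.biUnion fun i => cyclotomicClass α (l + 1) i := by
      rw [mem_biUnion_cyclotomicClass hα he]; simp
    have hsum := sum_signFun_biUnion hα he hI hc
    refine ⟨isAdesign_development hα h4 h0 hsum fun w hw =>
      diffCount_biUnion hα hl hq hI hc hw, fun _ _ => ?_⟩
    -- As l is odd, l ≥ 3, so no exception arises here.
    have hlt : l + 1 < Fintype.card F - 1 := by
      obtain ⟨k, hk⟩ := odd_of_card_eq_sq hodd hq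
      have := hl.one_lt
      have : 3 * l ≤ l ^ 2 := by rw [sq]; exact Nat.mul_le_mul_right l (by omega)
      omega
    have hne (k : ℕ) := biUnion_ne_cyclotomicClass_two (k := k) hα he (by omega) hi hie hj hjo
    exact nodup_development_add hα h4 h0 hsum
      (sum_biUnion_eq_zero hα he (by omega) hlt I) (hne 0) (hne 1)

end Main
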